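/- Let $A\in\mathbb{Z}^{m\times n}$ have rank $m$, and let $\mathbf{c}\in\mathbb{Q}^n$ satisfy $\mathbf{c}^\intercal\mathbf{x}\le 0$ for all $\mathbf{x}\in\mathbb{R}^n_{\ge 0}$ with $A\mathbf{x}=\mathbf{0}$. For $\mathbf{b}\in\mathbb{Z}^m$ let $\operatorname{IP}(\mathbf{b})$ be the integer program $\max\{\mathbf{c}^\intercal\mathbf{z} : A\mathbf{z}=\mathbf{b},\ \mathbf{z}\in\mathbb{Z}^n_{\ge 0}\}$. Let $\sigma(\mathbf{b})$ be the minimum of $|\{i : \mathbf{z}_i>0\}|$ over all optimal solutions $\mathbf{z}$ of $\operatorname{IP}(\mathbf{b})$, with $\sigma(\mathbf{b})=\infty$ if $\operatorname{IP}(\mathbf{b})$ is infeasible. Let $\delta$ and $\gamma$ be the maximum and the greatest common divisor, respectively, of the numbers $|\det(B)|$, where $B$ ranges over the $m\times m$ submatrices of $A$. For $\alpha\in\mathbb{R}$ define \[ \Pr(\sigma\le\alpha):=\liminf_{t\to\infty}\frac{|\{\mathbf{b}\in\mathbb{Z}^m : \sigma(\mathbf{b})\le\alpha,\ \|\mathbf{b}\|_\infty\le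 t,\ \sigma(\mathbf{b})<\infty\}|}{|\{\mathbf{b}\in\mathbb{Z}^m : \|\mathbf{b}\|_\infty\le t,\ \sigma(\mathbf{b})<\infty\}|}, \] where $t$ ranges over the positive integers. Then for each $k\in\{0,\dots,\lceil\log_2(\gamma^{-1}\delta)\rceil\}$, \[ \Pr(\sigma\le m+k)\ \ge\ \min\Big\{1,\ \frac{2^k}{\gamma^{-1}\delta}\Big\}. \] Moreover, $\Pr\big(\sigma\le m+\log_2(\gamma^{-1}\delta)\big)=1$. -/

import Mathlib

open Filter
open scoped ENNReal

noncomputable section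

namespace ParamIP

/-- `z` is feasible for `IP(b)`: `A z = b` and `z` is a nonnegative integer vector. -/
def IsFeasible {m n : ℕ} (A : Matrix (Fin m) (Fin n) ℤ) (b : Fin m → ℤ) (z : Fin n → ℤ) : Prop :=
  A.mulVec z = b ∧ ∀ i, 0 ≤ z i

/-- The objective value `cᵀ z` of an integer vector `z`. -/
def objective {n : ℕ} (c : Fin n → ℚ) (z : Fin n → ℤ) : ℚ :=
  ∑ i, c i * (z i : ℚ)

/-- `z` is an optimal solution of `IP(b) : max {cᵀ z : A z = b, z ∈ ℤ^n, z ≥ 0}`. -/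
def IsOptimal {m n : ℕ} (A : Matrix (Fin m) (Fin n) ℤ) (c : Fin n → ℚ) (b : Fin m → ℤ)
    (z : Fin n → ℤ) : Prop :=
  IsFeasible A b z ∧ ∀ w, IsFeasible A b w → objective c w ≤ objective c z

/-- The support of a (nonnegative) integer vector. -/
def supp {n : ℕ} (z : Fin n → ℤ) : Finset (Fin n) :=
  Finset.univ.filter fun i => 0 < z i

/-- The sparsity function `σ`: the minimal support size of an optimal solution of `IP(b)`,
and `∞` if there is none (the infimum over the empty set is `⊤`). -/
def sparsity {m n : ℕ} (A : Matrix (Fin m) (Fin n) ℤ) (c : Fin n → ℚ) (b : Fin m → ℤ) : ℝ≥0∞ :=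
  ⨅ (z : Fin n → ℤ) (_ : IsOptimal A c b z), ((supp z).card : ℝ≥0∞)

/-- `Pr_t(E)`: the proportion of elements of `E` among the vectors `b ∈ {-t, …, t}^m` with
`f b < ∞`. The norm on `Fin m → ℤ` is the maximum norm. -/
def densityAt {m : ℕ} (f : (Fin m → ℤ) → ℝ≥0∞) (E : Set (Fin m → ℤ)) (t : ℕ) : ℝ :=
  (({b : Fin m → ℤ | b ∈ E ∧ ‖b‖ ≤ (t : ℝ) ∧ f b < ∞}.ncard : ℕ) : ℝ) /
    (({b : Fin m → ℤ | ‖b‖ ≤ (t : ℝ) ∧ f b < ∞}.ncard : ℕ) : ℝ)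

/-- The lower asymptotic density `Pr(E) = liminf_{t → ∞} Pr_t(E)`. -/
def lowerDensity {m : ℕ} (f : (Fin m → ℤ) → ℝ≥0∞) (E : Set (Fin m → ℤ)) : ℝ :=
  liminf (fun t : ℕ => densityAt f E t) atTop

/-- `Pr(f ≤ α)`. The comparison takes place in the extended reals. -/
def probLE {m : ℕ} (f : (Fin m → ℤ) → ℝ≥0∞) (α : ℝ) : ℝ :=
  lowerDensity f {b | ((f b : ℝ≥0∞) : EReal) ≤ (α : EReal)}

/-- `|det B|` for the `m × m` submatrix `B` of `A` formed by the columns selected by `e`. -/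
def absMinor {m n : ℕ} (A : Matrix (Fin m) (Fin n) ℤ) (e : Fin m ↪o Fin n) : ℕ :=
  (A.submatrix id e).det.natAbs

/-- `δ`: the largest absolute value of the determinant of an `m × m` submatrix of `A`. -/
def maxMinor {m n : ℕ} (A : Matrix (Fin m) (Fin n) ℤ) : ℕ :=
  Finset.univ.sup (absMinor A)

/-- `γ`: the greatest common divisor of the absolute values of the determinants of the
`m × m` submatrices of `A`. -/
def gcdMinor {m n : ℕ} (A : Matrix (Fin m) (Fin n) ℤ) : ℕ :=
  Finset.univ.gcd (absMinor A)

end ParamIP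

end

/-!
For a basis `B` of the linear relaxation (`m` independent columns of `A`) with nonnegative reduced
costs, and a right-hand side `b` deep inside the cone of `B`, Gomory's group relaxation is exact:
write `b = A w + B y`, where `w ≥ 0` minimizes the reduced cost among all vectors whose image in the
finite group `ℤ^m / B ℤ^m` is the class of `b`. Depth makes `y` nonnegative, so `w` and `y` together
form an optimal solution, and its support has at most `m + |supp w|` elements
(`IsDualFeasible.exists_isOptimal`).

The support of `w` is controlled in the group. If `w` is optimal of minimal support, then the subset
sums over its support are pairwise distinct: two disjoint subsets with equal sums have equal cost, so
multiplicity could be moved from one to the other until an entry vanishes. Since optimality passes to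
smaller vectors, the subsets of a `k`-element part of the support give `2 ^ k` group elements that
need at most `k` nonzero entries (`min_le_ncard_sparseReachable`,
`reachable_subset_sparseReachable`). The relevant group `A ℤⁿ / B ℤ^m` has order at most
`|det B| / γ ≤ δ / γ` (`ncard_reachable_mul_gcdMinor_le`), because `γ` divides the index of `A ℤⁿ`.

It remains to count. Cones, and all sets obtained from them by Boolean operations, are invariant under
translations up to sets of density zero. Hence the classes modulo `B ℤ^m` are equidistributed in such
sets (`AsympInvariant.asympLE_preimage`), with no need for volumes, and the estimates on the cones
add up (`asympLE_biUnion`). The cones of the dual feasible bases cover all feasible right-hand sides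
up to finitely many hyperplanes: away from these, a basic optimal solution of the linear relaxation is
nondegenerate, and then its basis is dual feasible (`exists_isDualFeasible`).
-/

namespace ParamIP

open Asymptotics Topology

/-! ### Asymptotic density in `ℤ^m` -/

section Density

variable {m : ℕ}

/-- Number of points of the box `{-t, …, t}^m`. -/
def boxVolume (m t : ℕ) : ℝ := (2 * (t : ℝ) + 1) ^ m

/-- Number of elements of `S` in the box `{-t, …, t}^m`. -/
noncomputable def boxCount {m : ℕ} (S : Set (Fin m → ℤ)) (t : ℕ) : ℝ :=
  ({b : Fin m → ℤ | b ∈ S ∧ ‖b‖ ≤ (t : ℝ)}.ncard : ℝ)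

/-- `S` has asymptotic density zero in `ℤ^m`. -/
def Negligible {m : ℕ} (S : Set (Fin m → ℤ)) : Prop :=
  boxCount S =o[atTop] boxVolume m

/-- Every translation maps `S` into itself up to a set of density zero. -/
def AsympInvariant {m : ℕ} (S : Set (Fin m → ℤ)) : Prop :=
  ∀ v, Negligible {b | b ∈ S ∧ b + v ∉ S}

lemma boxVolume_pos (m t : ℕ) : 0 < boxVolume m t := by
  unfold boxVolume; positivity

lemma norm_le_natCast_iff (b : Fin m → ℤ) (t : ℕ) :
    ‖b‖ ≤ (t : ℝ) ↔ b ∈ Finset.Icc (fun _ : Fin m => -(t : ℤ)) (fun _ => (t : ℤ)) := by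
  rw [pi_norm_le_iff_of_nonneg (Nat.cast_nonneg t), Finset.mem_Icc, Pi.le_def, Pi.le_def,
    ← forall_and]
  refine forall_congr' fun i => ?_
  rw [Int.norm_eq_abs, ← abs_le]
  exact_mod_cast Iff.rfl

lemma finite_box (S : Set (Fin m → ℤ)) (t : ℕ) :
    {b : Fin m → ℤ | b ∈ S ∧ ‖b‖ ≤ (t : ℝ)}.Finite :=
  (Finset.finite_toSet (Finset.Icc (fun _ : Fin m => -(t : ℤ)) (fun _ => (t : ℤ)))).subset
    fun b hb => (norm_le_natCast_iff b t).1 hb.2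

lemma boxCount_nonneg (S : Set (Fin m → ℤ)) (t : ℕ) : 0 ≤ boxCount S t := Nat.cast_nonneg _

lemma boxCount_mono {S T : Set (Fin m → ℤ)} (h : S ⊆ T) (t : ℕ) : boxCount S t ≤ boxCount T t :=
  Nat.cast_le.2 (Set.ncard_le_ncard (fun _ hb => ⟨h hb.1, hb.2⟩) (finite_box T t))

lemma boxCount_union_le (S T : Set (Fin m → ℤ)) (t : ℕ) :
    boxCount (S ∪ T) t ≤ boxCount S t + boxCount T t := by
  unfold boxCount
  rw [← Nat.cast_add, Nat.cast_le]
  refine le_trans (le_of_eq ?_) (Set.ncard_union_le _ _)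
  congr 1
  ext b
  simp only [Set.mem_union, Set.mem_ofPred_eq]
  tauto

lemma boxCount_union {S T : Set (Fin m → ℤ)} (h : Disjoint S T) (t : ℕ) :
    boxCount (S ∪ T) t = boxCount S t + boxCount T t := by
  unfold boxCount
  rw [← Nat.cast_add, Nat.cast_inj, ← Set.ncard_union_eq _ (finite_box S t) (finite_box T t)]
  · congr 1
    ext b
    simp only [Set.mem_union, Set.mem_ofPred_eq]
    tauto
  · exact h.mono (fun _ hb => hb.1) (fun _ hb => hb.1)

lemma boxCount_univ (t : ℕ) : boxCount (Set.univ : Set (Fin m → ℤ)) t = boxVolume m t := by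
  have : {b : Fin m → ℤ | b ∈ (Set.univ : Set (Fin m → ℤ)) ∧ ‖b‖ ≤ (t : ℝ)} =
      ↑(Finset.Icc (fun _ : Fin m => -(t : ℤ)) (fun _ => (t : ℤ))) := by
    ext b
    simp [norm_le_natCast_iff]
  unfold boxCount boxVolume
  rw [this, Set.ncard_coe_finset, Pi.card_Icc]
  simp only [Int.card_Icc, Finset.prod_const, Finset.card_univ, Fintype.card_fin]
  have h : ((t : ℤ) + 1 - -(t : ℤ)).toNat = 2 * t + 1 := by omega
  rw [h]
  push_cast
  ring

lemma boxCount_biUnion {ι : Type*} [DecidableEq ι] (s : Finset ι) (S : ι → Set (Fin m → ℤ))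
    (h : (s : Set ι).PairwiseDisjoint S) (t : ℕ) :
    boxCount (⋃ i ∈ s, S i) t = ∑ i ∈ s, boxCount (S i) t := by
  induction s using Finset.induction_on with
  | empty => simp [boxCount]
  | insert a s ha ih =>
    rw [Finset.sum_insert ha, Finset.set_biUnion_insert, boxCount_union, ih]
    · exact h.subset (by simp)
    · rw [Set.disjoint_iUnion₂_right]
      intro i hi
      exact h (by simp) (by simp [hi]) (by rintro rfl; exact ha hi)

lemma isLittleO_boxVolume_add_sub (m r : ℕ) :
    (fun t => boxVolume m (t + r) - boxVolume m t) =o[atTop] boxVolume m := by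
  rw [isLittleO_iff_tendsto' (Eventually.of_forall fun t h => absurd h (boxVolume_pos m t).ne')]
  have h1 : Tendsto (fun t : ℕ => (2 * (r : ℝ)) / (2 * (t : ℝ) + 1)) atTop (𝓝 0) := by
    refine Tendsto.div_atTop tendsto_const_nhds ?_
    exact tendsto_atTop_add_const_right _ _
      (tendsto_natCast_atTop_atTop.const_mul_atTop (by norm_num))
  have h2 : Tendsto (fun t : ℕ => (1 + (2 * (r : ℝ)) / (2 * (t : ℝ) + 1)) ^ m - 1) atTop (𝓝 0) := by
    simpa using ((h1.const_add 1).pow m).sub_const 1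
  refine h2.congr fun t => ?_
  have : (2 * (t : ℝ) + 1) ≠ 0 := by positivity
  unfold boxVolume
  rw [sub_div, div_self (pow_ne_zero _ this), ← div_pow]
  congr 2
  push_cast
  field_simp
  ring

lemma boxCount_add_le (S : Set (Fin m → ℤ)) (t r : ℕ) :
    boxCount S (t + r) ≤ boxCount S t + (boxVolume m (t + r) - boxVolume m t) := by
  have key : ∀ s, boxCount S s + boxCount Sᶜ s = boxVolume m s := fun s => by
    rw [← boxCount_union disjoint_compl_right, Set.union_compl_self, boxCount_univ]
  have h1 := key t
  have h2 := key (t + r)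
  have h3 : boxCount Sᶜ t ≤ boxCount Sᶜ (t + r) :=
    Nat.cast_le.2 (Set.ncard_le_ncard
      (fun _ hb => ⟨hb.1, hb.2.trans (by push_cast; simp)⟩) (finite_box Sᶜ (t + r)))
  linarith

lemma boxCount_preimage_add_le (S : Set (Fin m → ℤ)) (v : Fin m → ℤ) (t : ℕ) :
    boxCount {b | b + v ∈ S} t ≤
      boxCount S t + (boxVolume m (t + ⌈‖v‖⌉₊) - boxVolume m t) := by
  refine le_trans ?_ (boxCount_add_le S t _)
  unfold boxCount
  rw [Nat.cast_le]
  refine Set.ncard_le_ncard_of_injOn (fun b => b + v) ?_ (fun a _ b _ h => add_right_cancel h)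
    (finite_box S _)
  rintro b ⟨hb, hbt⟩
  refine ⟨hb, (norm_add_le b v).trans ?_⟩
  push_cast
  exact add_le_add hbt (Nat.le_ceil _)

lemma Negligible.of_le {S : Set (Fin m → ℤ)} {f : ℕ → ℝ} (hf : f =o[atTop] boxVolume m)
    (h : ∀ t, boxCount S t ≤ f t) : Negligible S :=
  (IsBigO.of_bound 1 (Eventually.of_forall fun t => by
    rw [Real.norm_of_nonneg (boxCount_nonneg S t), one_mul]
    exact (h t).trans (le_abs_self _))).trans_isLittleO hf

lemma Negligible.mono {S T : Set (Fin m → ℤ)} (hT : Negligible T) (h : S ⊆ T) : Negligible S :=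
  Negligible.of_le hT (boxCount_mono h)

lemma negligible_empty : Negligible (∅ : Set (Fin m → ℤ)) :=
  Negligible.of_le (isLittleO_zero _ _) fun t => by simp [boxCount]

lemma Negligible.union {S T : Set (Fin m → ℤ)} (hS : Negligible S) (hT : Negligible T) :
    Negligible (S ∪ T) :=
  Negligible.of_le (hS.add hT) (boxCount_union_le S T)

lemma Negligible.biUnion {ι : Type*} {s : Set ι} (hs : s.Finite) {S : ι → Set (Fin m → ℤ)}
    (h : ∀ i ∈ s, Negligible (S i)) : Negligible (⋃ i ∈ s, S i) := by
  induction s, hs using Set.Finite.induction_on with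
  | empty => simpa using negligible_empty
  | insert _ _ ih =>
    rw [Set.biUnion_insert]
    exact (h _ (Set.mem_insert _ _)).union (ih fun i hi => h i (Set.mem_insert_of_mem _ hi))

lemma Negligible.preimage_add {S : Set (Fin m → ℤ)} (hS : Negligible S) (v : Fin m → ℤ) :
    Negligible {b | b + v ∈ S} :=
  Negligible.of_le (hS.add (isLittleO_boxVolume_add_sub m _)) (boxCount_preimage_add_le S v)

/-- A proper affine hyperplane has density zero: one coordinate of its points is determined by the
other ones. -/
lemma negligible_hyperplane (l : Fin m → ℚ) (hl : l ≠ 0) (a : ℚ) :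
    Negligible {b : Fin m → ℤ | ∑ i, l i * (b i : ℚ) = a} := by
  obtain ⟨i₀, hi₀⟩ := Function.ne_iff.1 hl
  obtain ⟨p, rfl⟩ : ∃ p, m = p + 1 := ⟨m - 1, by have := i₀.pos; omega⟩
  refine Negligible.of_le (f := fun t => boxVolume p t) ?_ fun t => ?_
  · rw [isLittleO_iff_tendsto'
      (Eventually.of_forall fun t h => absurd h (boxVolume_pos (p + 1) t).ne')]
    have h1 : Tendsto (fun t : ℕ => (2 * (t : ℝ) + 1)⁻¹) atTop (𝓝 0) :=
      tendsto_inv_atTop_zero.comp (tendsto_atTop_add_const_right _ _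
        (tendsto_natCast_atTop_atTop.const_mul_atTop (by norm_num)))
    refine h1.congr fun t => ?_
    have : (2 * (t : ℝ) + 1) ≠ 0 := by positivity
    unfold boxVolume
    field_simp
    ring
  · rw [← boxCount_univ]
    unfold boxCount
    rw [Nat.cast_le]
    refine Set.ncard_le_ncard_of_injOn (fun b j => b (i₀.succAbove j)) ?_ ?_ (finite_box _ _)
    · rintro b ⟨-, hb⟩
      refine ⟨trivial, ?_⟩
      rw [pi_norm_le_iff_of_nonneg (Nat.cast_nonneg t)] at hb ⊢
      exact fun j => hb _
    · rintro b ⟨hb, -⟩ b' ⟨hb', -⟩ h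
      have h' : ∀ j, b (i₀.succAbove j) = b' (i₀.succAbove j) := fun j => congrFun h j
      rw [Set.mem_ofPred_eq, Fin.sum_univ_succAbove _ i₀] at hb hb'
      simp only [h'] at hb
      have h0 : (b i₀ : ℚ) = b' i₀ := mul_left_cancel₀ hi₀ (by linarith)
      funext j
      rcases Fin.eq_self_or_eq_succAbove i₀ j with rfl | ⟨j, rfl⟩
      · exact_mod_cast h0
      · exact h' j

/-- The slab between two parallel hyperplanes contains lattice points of only finitely many parallel
hyperplanes. -/
lemma negligible_slab (l : Fin m → ℤ) (hl : l ≠ 0) (K : ℤ) :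
    Negligible {b : Fin m → ℤ | 0 ≤ l ⬝ᵥ b ∧ l ⬝ᵥ b < K} := by
  refine (Negligible.biUnion (Set.finite_Ico (0 : ℤ) K)
    (S := fun a => {b : Fin m → ℤ | ∑ i, (l i : ℚ) * (b i : ℚ) = a})
    fun a _ => negligible_hyperplane (fun i => (l i : ℚ)) ?_ _).mono ?_
  · intro h
    exact hl (funext fun i => by simpa using congrFun h i)
  · rintro b ⟨h0, h1⟩
    simp only [Set.mem_iUnion]
    refine ⟨l ⬝ᵥ b, ⟨h0, h1⟩, ?_⟩
    simp [dotProduct]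

lemma asympInvariant_univ : AsympInvariant (Set.univ : Set (Fin m → ℤ)) := fun v => by
  simpa using negligible_empty

lemma asympInvariant_halfspace (l : Fin m → ℤ) : AsympInvariant {b : Fin m → ℤ | 0 ≤ l ⬝ᵥ b} := by
  intro v
  by_cases hl : l = 0
  · simpa [hl] using negligible_empty
  · refine (negligible_slab l hl (-(l ⬝ᵥ v))).mono ?_
    rintro b ⟨h0, h1⟩
    simp only [Set.mem_ofPred_eq, dotProduct_add, not_le] at h0 h1 ⊢
    exact ⟨h0, by linarith⟩

lemma AsympInvariant.iInter {ι : Type*} [Finite ι] {S : ι → Set (Fin m → ℤ)}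
    (h : ∀ i, AsympInvariant (S i)) : AsympInvariant (⋂ i, S i) := by
  intro v
  refine (Negligible.biUnion (Set.finite_univ (α := ι)) fun i _ => h i v).mono ?_
  rintro b ⟨h0, h1⟩
  simp only [Set.mem_iInter, not_forall] at h0 h1
  obtain ⟨i, hi⟩ := h1
  simp only [Set.mem_iUnion]
  exact ⟨i, trivial, h0 i, hi⟩

lemma AsympInvariant.inter {S T : Set (Fin m → ℤ)} (hS : AsympInvariant S)
    (hT : AsympInvariant T) : AsympInvariant (S ∩ T) := by
  intro v
  refine ((hS v).union (hT v)).mono ?_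
  rintro b ⟨⟨h0, h1⟩, h2⟩
  by_cases h : b + v ∈ S
  · exact Or.inr ⟨h1, fun h' => h2 ⟨h, h'⟩⟩
  · exact Or.inl ⟨h0, h⟩

lemma AsympInvariant.compl {S : Set (Fin m → ℤ)} (hS : AsympInvariant S) :
    AsympInvariant Sᶜ := by
  intro v
  refine ((hS (-v)).preimage_add v).mono ?_
  rintro b ⟨h0, h1⟩
  simp only [Set.mem_compl_iff, not_not] at h0 h1
  exact ⟨h1, by simpa using h0⟩

/-- The relation `ρ · |X ∩ box| ≤ |Y ∩ box| + o(|box|)`. -/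
def AsympLE (ρ : ℝ) (X Y : Set (Fin m → ℤ)) : Prop :=
  ∃ err : ℕ → ℝ, err =o[atTop] boxVolume m ∧ ∀ t, ρ * boxCount X t ≤ boxCount Y t + err t

lemma AsympLE.union {ρ : ℝ} {X X' Y Y' : Set (Fin m → ℤ)} (hρ : 0 ≤ ρ) (h : AsympLE ρ X Y)
    (h' : AsympLE ρ X' Y') (hY : Disjoint Y Y') : AsympLE ρ (X ∪ X') (Y ∪ Y') := by
  obtain ⟨e, he, hle⟩ := h
  obtain ⟨e', he', hle'⟩ := h'
  refine ⟨fun t => e t + e' t, he.add he', fun t => ?_⟩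
  rw [boxCount_union hY]
  have := mul_le_mul_of_nonneg_left (boxCount_union_le X X' t) hρ
  linarith [hle t, hle' t]

/-- Negligible sets may be ignored in asymptotic comparisons. -/
lemma AsympLE.of_union_negligible {ρ : ℝ} {X X' Y Y' : Set (Fin m → ℤ)} (hρ : 0 ≤ ρ)
    (hX' : Negligible X') (hY' : Negligible Y') (h : AsympLE ρ X Y) {X₁ Y₁ : Set (Fin m → ℤ)}
    (hX : X₁ ⊆ X ∪ X') (hY : Y ⊆ Y₁ ∪ Y') : AsympLE ρ X₁ Y₁ := by
  obtain ⟨e, he, hle⟩ := h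
  refine ⟨fun t => e t + (ρ * boxCount X' t + boxCount Y' t),
    he.add ((hX'.const_mul_left ρ).add hY'), fun t => ?_⟩
  have h1 := mul_le_mul_of_nonneg_left ((boxCount_mono hX t).trans (boxCount_union_le X X' t)) hρ
  have h2 := (boxCount_mono hY t).trans (boxCount_union_le Y₁ Y' t)
  linarith [hle t]

/-- In an asymptotically invariant set, all fibres of a homomorphism to a finite group have
asymptotically the same size. -/
lemma AsympInvariant.asympLE_fibre {G : Type*} [AddCommGroup G] {S : Set (Fin m → ℤ)}
    (hS : AsympInvariant S) (φ : (Fin m → ℤ) →+ G) (hφ : Function.Surjective φ) (g g' : G) :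
    AsympLE 1 (S ∩ φ ⁻¹' {g}) (S ∩ φ ⁻¹' {g'}) := by
  obtain ⟨v, hv⟩ := hφ (g' - g)
  refine ⟨fun t => (boxVolume m (t + ⌈‖v‖⌉₊) - boxVolume m t) + boxCount {b | b ∈ S ∧ b + v ∉ S} t,
    (isLittleO_boxVolume_add_sub m _).add (hS v), fun t => ?_⟩
  have h1 : S ∩ φ ⁻¹' {g} ⊆ {b | b + v ∈ S ∩ φ ⁻¹' {g'}} ∪ {b | b ∈ S ∧ b + v ∉ S} := by
    rintro b ⟨hb, hg⟩
    by_cases h : b + v ∈ S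
    · refine Or.inl ⟨h, ?_⟩
      have hg : φ b = g := hg
      simp [hg, hv]
    · exact Or.inr ⟨hb, h⟩
  have h2 := (boxCount_mono h1 t).trans (boxCount_union_le _ _ t)
  have h3 := boxCount_preimage_add_le (S ∩ φ ⁻¹' {g'}) v t
  linarith

/-- Equidistribution of the fibres over a set `R`, in terms of the proportion of a subset `H`. -/
lemma AsympInvariant.asympLE_preimage {G : Type*} [AddCommGroup G] {S : Set (Fin m → ℤ)}
    (hS : AsympInvariant S) (φ : (Fin m → ℤ) →+ G) (hφ : Function.Surjective φ)
    (R H : Finset G) (ρ : ℝ) (hρ : ρ * R.card ≤ H.card) :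
    AsympLE ρ (S ∩ φ ⁻¹' R) (S ∩ φ ⁻¹' H) := by
  classical
  rcases R.eq_empty_or_nonempty with rfl | hR
  · exact ⟨fun _ => 0, isLittleO_zero _ _, fun t => by simp [boxCount]⟩
  choose e he hle using fun g g' => hS.asympLE_fibre φ hφ g g'
  have hsum : ∀ (T : Finset G) t,
      boxCount (S ∩ φ ⁻¹' T) t = ∑ g ∈ T, boxCount (S ∩ φ ⁻¹' {g}) t := by
    intro T t
    rw [← boxCount_biUnion]
    · congr 1
      ext b
      simp
    · intro g _ g' _ hne
      rw [Function.onFun, Set.disjoint_left]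
      rintro b ⟨-, hb⟩ ⟨-, hb'⟩
      exact hne (hb.symm.trans hb')
  have hRpos : (0 : ℝ) < R.card := Nat.cast_pos.2 hR.card_pos
  have herr : (fun t => ∑ g ∈ R, ∑ g' ∈ H, e g g' t) =o[atTop] boxVolume m :=
    IsLittleO.fun_sum fun g _ => IsLittleO.fun_sum fun g' _ => he g g'
  refine ⟨fun t => (R.card : ℝ)⁻¹ * ∑ g ∈ R, ∑ g' ∈ H, e g g' t, herr.const_mul_left _,
    fun t => ?_⟩
  have h1 : (H.card : ℝ) * boxCount (S ∩ φ ⁻¹' R) t ≤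
      R.card * boxCount (S ∩ φ ⁻¹' H) t + ∑ g ∈ R, ∑ g' ∈ H, e g g' t := by
    calc (H.card : ℝ) * boxCount (S ∩ φ ⁻¹' R) t
        = ∑ g ∈ R, ∑ g' ∈ H, boxCount (S ∩ φ ⁻¹' {g}) t := by
          rw [hsum, Finset.mul_sum]
          simp
      _ ≤ ∑ g ∈ R, ∑ g' ∈ H, (boxCount (S ∩ φ ⁻¹' {g'}) t + e g g' t) := by
          gcongr with g _ g' _
          exact (one_mul (boxCount (S ∩ φ ⁻¹' {g}) t)).symm.le.trans (hle g g' t)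
      _ = _ := by
          simp only [Finset.sum_add_distrib]
          rw [hsum H]
          simp
  have h2 := mul_le_mul_of_nonneg_right hρ (boxCount_nonneg (S ∩ φ ⁻¹' R) t)
  have h3 : (R.card : ℝ) * (ρ * boxCount (S ∩ φ ⁻¹' R) t) ≤
      R.card * (boxCount (S ∩ φ ⁻¹' H) t + (R.card : ℝ)⁻¹ * ∑ g ∈ R, ∑ g' ∈ H, e g g' t) := by
    rw [mul_add, mul_inv_cancel_left₀ hRpos.ne']
    linarith
  exact le_of_mul_le_mul_left h3 hRpos

/-- Asymptotic comparisons on the parts of a finite cover by asymptotically invariant sets, stable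
under passing to asymptotically invariant subsets, combine to a comparison on the whole cover. -/
lemma asympLE_biUnion {ι : Type*} [DecidableEq ι] (s : Finset ι) (S : ι → Set (Fin m → ℤ))
    (hS : ∀ i ∈ s, AsympInvariant (S i)) {ρ : ℝ} (hρ : 0 ≤ ρ) (X Y : Set (Fin m → ℤ))
    (h : ∀ i ∈ s, ∀ T, AsympInvariant T → AsympLE ρ (S i ∩ T ∩ X) (S i ∩ T ∩ Y))
    (T : Set (Fin m → ℤ)) (hT : AsympInvariant T) :
    AsympLE ρ ((⋃ i ∈ s, S i) ∩ T ∩ X) ((⋃ i ∈ s, S i) ∩ T ∩ Y) := by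
  induction s using Finset.induction_on generalizing T with
  | empty => exact ⟨fun _ => 0, isLittleO_zero _ _, fun t => by simp [boxCount]⟩
  | insert a s ha ih =>
    have h1 := h a (by simp) T hT
    have h2 := ih (fun i hi => hS i (by simp [hi])) (fun i hi => h i (by simp [hi]))
      (T ∩ (S a)ᶜ) (hT.inter (hS a (by simp)).compl)
    have hsplit : ∀ Z, (⋃ i ∈ insert a s, S i) ∩ T ∩ Z =
        (S a ∩ T ∩ Z) ∪ ((⋃ i ∈ s, S i) ∩ (T ∩ (S a)ᶜ) ∩ Z) := by
      intro Z
      rw [Finset.set_biUnion_insert]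
      ext b
      simp only [Set.mem_inter_iff, Set.mem_union, Set.mem_compl_iff]
      tauto
    rw [hsplit, hsplit]
    refine h1.union hρ h2 ?_
    rw [Set.disjoint_left]
    rintro b ⟨⟨hb, -⟩, -⟩ ⟨⟨-, -, hb'⟩, -⟩
    exact hb' hb

end Density

/-! ### Sparse solutions of group problems -/

section GroupRelaxation

variable {ι G : Type*} [Fintype ι] [AddCommGroup G]

/-- `w` has minimal cost `∑ w_j d_j` among all nonnegative integer vectors with the same value of
`∑ w_j a_j` in `G`, i.e. `w` solves a group problem in the sense of Gomory. -/
def IsGroupOptimal (a : ι → G) (d : ι → ℚ) (w : ι → ℕ) : Prop :=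
  ∀ w' : ι → ℕ, ∑ j, w' j • a j = ∑ j, w j • a j → ∑ j, w j • d j ≤ ∑ j, w' j • d j

/-- The group elements which are nonnegative integer combinations of the `a_j`. -/
def reachable (a : ι → G) : Set G := Set.range fun w : ι → ℕ => ∑ j, w j • a j

/-- The support of a vector of natural numbers. -/
def natSupp (w : ι → ℕ) : Finset ι := Finset.univ.filter fun j => w j ≠ 0

/-- The group elements whose group problem has an optimal solution with at most `k` nonzero
entries. -/
def sparseReachable (a : ι → G) (d : ι → ℚ) (k : ℕ) : Set G :=
  {g | ∃ w, IsGroupOptimal a d w ∧ ∑ j, w j • a j = g ∧ (natSupp w).card ≤ k}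

lemma mem_natSupp {w : ι → ℕ} {j : ι} : j ∈ natSupp w ↔ w j ≠ 0 := by simp [natSupp]

lemma sparseReachable_subset (a : ι → G) (d : ι → ℚ) (k : ℕ) :
    sparseReachable a d k ⊆ reachable a := by
  rintro _ ⟨w, -, rfl, -⟩
  exact ⟨w, rfl⟩

/-- Multiplicities may be reduced modulo the order of the group, so a minimal cost is attained. -/
lemma exists_isGroupOptimal [Finite G] (a : ι → G) (d : ι → ℚ) (hd : ∀ j, 0 ≤ d j) (w₀ : ι → ℕ) :
    ∃ w, IsGroupOptimal a d w ∧ ∑ j, w j • a j = ∑ j, w₀ j • a j := by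
  classical
  have hN : 0 < Nat.card G := Nat.card_pos
  have hred : ∀ w : ι → ℕ, ∑ j, (w j % Nat.card G) • a j = ∑ j, w j • a j := fun w =>
    Finset.sum_congr rfl fun j _ => by
      conv_rhs => rw [← Nat.mod_add_div (w j) (Nat.card G), add_smul, mul_comm, mul_smul,
        card_nsmul_eq_zero', smul_zero, add_zero]
  let F : Finset (ι → ℕ) := (Fintype.piFinset fun _ => Finset.range (Nat.card G)).filter
    fun w => ∑ j, w j • a j = ∑ j, w₀ j • a j
  have hF : ∀ w : ι → ℕ, ∑ j, w j • a j = ∑ j, w₀ j • a j →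
      (fun j => w j % Nat.card G) ∈ F := fun w hw => by
    simp only [F, Finset.mem_filter, Fintype.mem_piFinset, Finset.mem_range]
    exact ⟨fun j => Nat.mod_lt _ hN, (hred w).trans hw⟩
  obtain ⟨w, hwF, hmin⟩ := Finset.exists_min_image F (fun w => ∑ j, w j • d j) ⟨_, hF w₀ rfl⟩
  have hw : ∑ j, w j • a j = ∑ j, w₀ j • a j := (Finset.mem_filter.1 hwF).2
  refine ⟨w, fun w' hw' => (hmin _ (hF w' (hw'.trans hw))).trans ?_, hw⟩
  exact Finset.sum_le_sum fun j _ => nsmul_le_nsmul_left (hd j) (Nat.mod_le _ _)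

lemma sum_smul_eq_sub_add {M : Type*} [AddCommMonoid M] {w u : ι → ℕ} (hu : u ≤ w) (f : ι → M) :
    ∑ j, w j • f j = ∑ j, (w j - u j) • f j + ∑ j, u j • f j := by
  rw [← Finset.sum_add_distrib]
  exact Finset.sum_congr rfl fun j _ => by rw [← add_smul, Nat.sub_add_cancel (hu j)]

/-- Optimality is inherited by smaller vectors. -/
lemma IsGroupOptimal.mono {a : ι → G} {d : ι → ℚ} {w u : ι → ℕ} (hw : IsGroupOptimal a d w)
    (hu : u ≤ w) : IsGroupOptimal a d u := by
  intro u' hu'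
  have h := hw (fun j => (w j - u j) + u' j) (by
    simp only [add_smul, Finset.sum_add_distrib]
    rw [sum_smul_eq_sub_add hu a, hu'])
  simp only [add_smul, Finset.sum_add_distrib] at h
  rw [sum_smul_eq_sub_add hu d] at h
  linarith

lemma sum_exchange [DecidableEq ι] {M : Type*} [AddCommMonoid M] (f : ι → M) {w w' : ι → ℕ}
    {q : ℕ} {S T : Finset ι}
    (h : ∀ j, w' j + (if j ∈ S then q else 0) = w j + (if j ∈ T then q else 0)) :
    ∑ j, w' j • f j + q • ∑ j ∈ S, f j = ∑ j, w j • f j + q • ∑ j ∈ T, f j := by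
  have hind : ∀ U : Finset ι, q • ∑ j ∈ U, f j = ∑ j, (if j ∈ U then q else 0) • f j := fun U => by
    simp [ite_smul, Finset.sum_ite_mem, Finset.smul_sum]
  rw [hind, hind, ← Finset.sum_add_distrib, ← Finset.sum_add_distrib]
  exact Finset.sum_congr rfl fun j _ => by rw [← add_smul, h, add_smul]

/-- If two disjoint subsets of the support of an optimal vector have the same sum, then they have the
same cost, and multiplicity can be moved from one to the other until an entry vanishes. -/
lemma IsGroupOptimal.exists_smaller [DecidableEq ι] {a : ι → G} {d : ι → ℚ} {w : ι → ℕ}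
    (hw : IsGroupOptimal a d w) {S T : Finset ι} (hS : S ⊆ natSupp w) (hT : T ⊆ natSupp w)
    (hST : Disjoint S T) (hne : S.Nonempty) (hsum : ∑ j ∈ S, a j = ∑ j ∈ T, a j) :
    ∃ w', IsGroupOptimal a d w' ∧ ∑ j, w' j • a j = ∑ j, w j • a j ∧
      (natSupp w').card < (natSupp w).card := by
  have hnot : ∀ j ∈ S, j ∉ T := fun j h h' => Finset.disjoint_left.1 hST h h'
  have hcost : ∑ j ∈ T, d j ≤ ∑ j ∈ S, d j := by
    have hex : ∀ j, (w j + (if j ∈ S then 1 else 0) - (if j ∈ T then 1 else 0)) +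
        (if j ∈ T then 1 else 0) = w j + (if j ∈ S then 1 else 0) := fun j => by
      by_cases h : j ∈ T
      · have := mem_natSupp.1 (hT h)
        simp only [h, if_true]
        omega
      · simp [h]
    have h1 := sum_exchange a hex
    have h2 := sum_exchange d hex
    rw [hsum] at h1
    have h3 := hw _ (add_right_cancel h1)
    simp only [one_smul] at h2
    linarith
  obtain ⟨j₀, hj₀, hmin⟩ := S.exists_min_image w hne
  have hex : ∀ j, (w j + (if j ∈ T then w j₀ else 0) - (if j ∈ S then w j₀ else 0)) +
      (if j ∈ S then w j₀ else 0) = w j + (if j ∈ T then w j₀ else 0) := fun j => by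
    by_cases h : j ∈ S
    · have := hmin j h
      simp only [h, if_true]
      omega
    · simp [h]
  have h1 := sum_exchange a hex
  have h2 := sum_exchange d hex
  rw [hsum] at h1
  have h3 := add_right_cancel h1
  refine ⟨_, fun w' hw' => ?_, h3, Finset.card_lt_card ?_⟩
  · have h4 := hw w' (hw'.trans h3)
    have h5 := nsmul_le_nsmul_right hcost (w j₀)
    linarith
  · rw [Finset.ssubset_iff_of_subset]
    · refine ⟨j₀, hS hj₀, ?_⟩
      simp [mem_natSupp, hj₀, hnot j₀ hj₀]
    · intro j hj
      by_contra hj'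
      have hjS : j ∉ S := fun h => hj' (hS h)
      have hjT : j ∉ T := fun h => hj' (hT h)
      rw [mem_natSupp] at hj hj'
      simp [hjS, hjT] at hj
      exact hj' hj

/-- An optimal vector of minimal support has pairwise distinct subset sums over its support. -/
lemma exists_isGroupOptimal_injOn [Finite G] (a : ι → G) (d : ι → ℚ) (hd : ∀ j, 0 ≤ d j)
    {g : G} (hg : g ∈ reachable a) :
    ∃ w, IsGroupOptimal a d w ∧ ∑ j, w j • a j = g ∧
      Set.InjOn (fun S : Finset ι => ∑ j ∈ S, a j) {S | S ⊆ natSupp w} := by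
  classical
  obtain ⟨w₀, rfl⟩ := hg
  obtain ⟨w₁, hw₁⟩ := exists_isGroupOptimal a d hd w₀
  let P : Set (ι → ℕ) := {w | IsGroupOptimal a d w ∧ ∑ j, w j • a j = ∑ j, w₀ j • a j}
  obtain ⟨w, ⟨hw, hwg⟩, hmin⟩ : ∃ w ∈ P, ∀ w' ∈ P, (natSupp w).card ≤ (natSupp w').card := by
    have hne : ((fun w => (natSupp w).card) '' P).Nonempty := ⟨_, w₁, hw₁, rfl⟩
    obtain ⟨w, hw, hw'⟩ := Nat.sInf_mem hne
    refine ⟨w, hw, fun w' h' => ?_⟩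
    simp only [] at hw'
    rw [hw']
    exact Nat.sInf_le ⟨w', h', rfl⟩
  have hno : ∀ S T : Finset ι, S ⊆ natSupp w → T ⊆ natSupp w → Disjoint S T → S.Nonempty →
      ∑ j ∈ S, a j ≠ ∑ j ∈ T, a j := fun S T hS hT hST hne hsum => by
    obtain ⟨w', h1, h2, h3⟩ := hw.exists_smaller hS hT hST hne hsum
    exact absurd (hmin w' ⟨h1, h2.trans hwg⟩) (not_le.2 h3)
  refine ⟨w, hw, hwg, fun S hS T hT hsum => ?_⟩
  have hS : S ⊆ natSupp w := hS
  have hT : T ⊆ natSupp w := hT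
  have hsum' : ∑ j ∈ S \ T, a j = ∑ j ∈ T \ S, a j := by
    have h1 := Finset.sum_inter_add_sum_sdiff S T a
    have h2 := Finset.sum_inter_add_sum_sdiff T S a
    have hsum : ∑ j ∈ S, a j = ∑ j ∈ T, a j := hsum
    rw [Finset.inter_comm] at h2
    rw [← h2, ← h1] at hsum
    exact add_left_cancel hsum
  refine Finset.Subset.antisymm ?_ ?_ <;> rw [← Finset.sdiff_eq_empty_iff_subset] <;>
    by_contra hne
  · exact hno _ _ (Finset.sdiff_subset.trans hS) (Finset.sdiff_subset.trans hT)
      disjoint_sdiff_sdiff (Finset.nonempty_iff_ne_empty.2 hne) hsum'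
  · exact hno _ _ (Finset.sdiff_subset.trans hT) (Finset.sdiff_subset.trans hS)
      disjoint_sdiff_sdiff (Finset.nonempty_iff_ne_empty.2 hne) hsum'.symm

lemma sum_indicator_smul [DecidableEq ι] {M : Type*} [AddCommMonoid M] (f : ι → M) (S : Finset ι) :
    ∑ j, (if j ∈ S then 1 else 0) • f j = ∑ j ∈ S, f j := by
  simp [ite_smul, Finset.sum_ite_mem]

/-- If an optimal vector has distinct subset sums over its support, then the subsets of any `K`
inside the support produce `2 ^ |K|` different group elements of sparsity at most `|K|`. -/
lemma IsGroupOptimal.two_pow_le [Finite G] {a : ι → G} {d : ι → ℚ} {w : ι → ℕ}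
    (hw : IsGroupOptimal a d w)
    (hinj : Set.InjOn (fun S : Finset ι => ∑ j ∈ S, a j) {S | S ⊆ natSupp w}) {K : Finset ι}
    (hK : K ⊆ natSupp w) : 2 ^ K.card ≤ (sparseReachable a d K.card).ncard := by
  classical
  rw [← Finset.card_powerset, ← Set.ncard_coe_finset]
  refine Set.ncard_le_ncard_of_injOn (fun S => ∑ j ∈ S, a j) (fun S hS => ?_)
    (hinj.mono fun S hS => (Finset.mem_powerset.1 hS).trans hK) (Set.toFinite _)
  have hS : S ⊆ K := Finset.mem_powerset.1 hS
  refine ⟨fun j => if j ∈ S then 1 else 0, hw.mono fun j => ?_, sum_indicator_smul a S,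
    Finset.card_le_card fun j hj => ?_⟩
  · by_cases h : j ∈ S
    · have := mem_natSupp.1 (hK (hS h))
      simp only [h, if_true]
      omega
    · simp [h]
  · rw [mem_natSupp] at hj
    exact hS (by simpa using hj)

/-- At least `min (2 ^ k) |R|` elements of the set `R` of reachable group elements have sparsity at
most `k`. -/
lemma min_le_ncard_sparseReachable [Finite G] (a : ι → G) (d : ι → ℚ) (hd : ∀ j, 0 ≤ d j) (k : ℕ) :
    min (2 ^ k) (reachable a).ncard ≤ (sparseReachable a d k).ncard := by
  by_cases h : reachable a ⊆ sparseReachable a d k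
  · exact (min_le_right _ _).trans (Set.ncard_le_ncard h (Set.toFinite _))
  · obtain ⟨g, hg, hgk⟩ := Set.not_subset.1 h
    obtain ⟨w, hw, hwg, hinj⟩ := exists_isGroupOptimal_injOn a d hd hg
    have hk : k ≤ (natSupp w).card := by
      by_contra hlt
      exact hgk ⟨w, hw, hwg, (not_le.1 hlt).le⟩
    obtain ⟨K, hK, rfl⟩ := Finset.exists_subset_card_eq hk
    exact (min_le_left _ _).trans (hw.two_pow_le hinj hK)

/-- Every reachable group element has sparsity at most `log₂ |R|`. -/
lemma reachable_subset_sparseReachable [Finite G] (a : ι → G) (d : ι → ℚ) (hd : ∀ j, 0 ≤ d j)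
    {k : ℕ} (hk : (reachable a).ncard < 2 ^ (k + 1)) : reachable a ⊆ sparseReachable a d k := by
  intro g hg
  obtain ⟨w, hw, hwg, hinj⟩ := exists_isGroupOptimal_injOn a d hd hg
  refine ⟨w, hw, hwg, ?_⟩
  have h := (hw.two_pow_le hinj subset_rfl).trans
    (Set.ncard_le_ncard (sparseReachable_subset a d _) (Set.toFinite _))
  exact Nat.lt_succ_iff.1 ((Nat.pow_lt_pow_iff_right one_lt_two).1 (h.trans_lt hk))

end GroupRelaxation

/-! ### Basic optimal solutions of linear programs -/

section LinearProgram

variable {ι V : Type*} [Fintype ι] [AddCommGroup V] [Module ℚ V]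

/-- The indices of the nonzero entries of a rational vector. -/
def ratSupp (x : ι → ℚ) : Finset ι := Finset.univ.filter fun j => x j ≠ 0

lemma mem_ratSupp {x : ι → ℚ} {j : ι} : j ∈ ratSupp x ↔ x j ≠ 0 := by simp [ratSupp]

/-- Moving along a kernel vector with a negative entry inside the support of a feasible point until
an entry vanishes. -/
lemma exists_step (x v : ι → ℚ) (hx : ∀ j, 0 ≤ x j) (hv : ∀ j, x j = 0 → v j = 0)
    (hneg : ∃ j, v j < 0) :
    ∃ ε : ℚ, 0 ≤ ε ∧ (∀ j, 0 ≤ x j + ε * v j) ∧ ∃ j, x j ≠ 0 ∧ x j + ε * v j = 0 := by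
  classical
  obtain ⟨j₁, hj₁⟩ := hneg
  obtain ⟨j₀, hj₀, hmin⟩ := Finset.exists_min_image (Finset.univ.filter fun j => v j < 0)
    (fun j => x j / -v j) ⟨j₁, by simpa using hj₁⟩
  have hj₀ : v j₀ < 0 := by simpa using hj₀
  have hε : 0 ≤ x j₀ / -v j₀ := div_nonneg (hx _) (by linarith)
  refine ⟨x j₀ / -v j₀, hε, fun j => ?_, j₀, fun h => hj₀.ne (hv _ h), ?_⟩
  · rcases lt_or_ge (v j) 0 with h | h
    · have h1 := hmin j (by simpa using h)
      rw [le_div_iff₀ (by linarith)] at h1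
      linarith
    · have := mul_nonneg hε h
      linarith [hx j]
  · have : v j₀ ≠ 0 := hj₀.ne
    field_simp
    ring

/-- If the objective is nonpositive on all nonnegative kernel vectors, every feasible point of a
linear program can be replaced by a basic one without decreasing the objective. -/
lemma exists_basic (a : ι → V) (c : ι → ℚ)
    (hc : ∀ x : ι → ℚ, (∀ j, 0 ≤ x j) → ∑ j, x j • a j = 0 → ∑ j, c j * x j ≤ 0)
    (x : ι → ℚ) (hx : ∀ j, 0 ≤ x j) :
    ∃ y : ι → ℚ, (∀ j, 0 ≤ y j) ∧ ∑ j, y j • a j = ∑ j, x j • a j ∧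
      ∑ j, c j * x j ≤ ∑ j, c j * y j ∧ LinearIndepOn ℚ a (ratSupp y : Set ι) := by
  classical
  induction hn : (ratSupp x).card using Nat.strong_induction_on generalizing x with
  | _ n ih =>
  by_cases hli : LinearIndepOn ℚ a (ratSupp x : Set ι)
  · exact ⟨x, hx, rfl, le_rfl, hli⟩
  · -- a kernel vector supported in the support of `x`
    obtain ⟨v, hvx, hv0, j₁, hvj₁⟩ : ∃ v : ι → ℚ, (∀ j, x j = 0 → v j = 0) ∧
        ∑ j, v j • a j = 0 ∧ ∃ j, v j ≠ 0 := by
      rw [linearIndepOn_finset_iff] at hli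
      push Not at hli
      obtain ⟨g, hg, j, hj, hgj⟩ := hli
      refine ⟨fun j => if j ∈ ratSupp x then g j else 0, fun j h => ?_, ?_, j, by simpa [hj]⟩
      · simp [mem_ratSupp, h]
      · simpa [ite_smul, Finset.sum_ite_mem] using hg
    obtain ⟨u, hux, hu0, hneg, huc⟩ : ∃ u : ι → ℚ, (∀ j, x j = 0 → u j = 0) ∧
        ∑ j, u j • a j = 0 ∧ (∃ j, u j < 0) ∧ 0 ≤ ∑ j, c j * u j := by
      have key : ∀ v : ι → ℚ, (∀ j, x j = 0 → v j = 0) → ∑ j, v j • a j = 0 → (∃ j, v j ≠ 0) →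
          0 ≤ ∑ j, c j * v j → ∃ u : ι → ℚ, (∀ j, x j = 0 → u j = 0) ∧
          ∑ j, u j • a j = 0 ∧ (∃ j, u j < 0) ∧ 0 ≤ ∑ j, c j * u j := by
        rintro v hvx hv0 ⟨j₁, hj₁⟩ hvc
        by_cases hneg : ∃ j, v j < 0
        · exact ⟨v, hvx, hv0, hneg, hvc⟩
        · push Not at hneg
          refine ⟨fun j => -v j, fun j h => by simp [hvx j h], by simp [hv0],
            ⟨j₁, by have := lt_of_le_of_ne (hneg j₁) hj₁.symm; simpa using this⟩, ?_⟩
          have := hc v hneg hv0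
          simpa using this
      rcases le_total 0 (∑ j, c j * v j) with h | h
      · exact key v hvx hv0 ⟨j₁, hvj₁⟩ h
      · exact key (fun j => -v j) (fun j h => by simp [hvx j h]) (by simp [hv0])
          ⟨j₁, by simpa using hvj₁⟩ (by simpa using h)
    obtain ⟨ε, hε, hpos, j₂, hj₂, hj₂'⟩ := exists_step x u hx hux hneg
    obtain ⟨y, hy, hyx, hyc, hyli⟩ := ih (ratSupp fun j => x j + ε * u j).card (by
      rw [← hn]
      refine Finset.card_lt_card ((Finset.ssubset_iff_of_subset ?_).2
        ⟨j₂, mem_ratSupp.2 hj₂, by simp [mem_ratSupp, hj₂']⟩)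
      intro j hj
      rw [mem_ratSupp] at hj ⊢
      intro h
      exact hj (by simp [h, hux j h])) _ hpos rfl
    refine ⟨y, hy, hyx.trans ?_, le_trans ?_ hyc, hyli⟩
    · simp only [add_smul, mul_smul, Finset.sum_add_distrib, ← Finset.smul_sum, hu0, smul_zero,
        add_zero]
    · have : ∑ j, c j * (x j + ε * u j) = ∑ j, c j * x j + ε * ∑ j, c j * u j := by
        rw [Finset.mul_sum, ← Finset.sum_add_distrib]
        exact Finset.sum_congr rfl fun j _ => by ring
      rw [this]
      have := mul_nonneg hε huc
      linarith

/-- Under the same hypothesis, a feasible linear program has a basic optimal solution. -/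
lemma exists_basic_optimal (a : ι → V) (c : ι → ℚ)
    (hc : ∀ x : ι → ℚ, (∀ j, 0 ≤ x j) → ∑ j, x j • a j = 0 → ∑ j, c j * x j ≤ 0)
    (x : ι → ℚ) (hx : ∀ j, 0 ≤ x j) :
    ∃ y : ι → ℚ, (∀ j, 0 ≤ y j) ∧ ∑ j, y j • a j = ∑ j, x j • a j ∧
      LinearIndepOn ℚ a (ratSupp y : Set ι) ∧
      ∀ z : ι → ℚ, (∀ j, 0 ≤ z j) → ∑ j, z j • a j = ∑ j, x j • a j →
        ∑ j, c j * z j ≤ ∑ j, c j * y j := by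
  classical
  let P : Set (ι → ℚ) := {y | (∀ j, 0 ≤ y j) ∧ ∑ j, y j • a j = ∑ j, x j • a j ∧
      LinearIndepOn ℚ a (ratSupp y : Set ι)}
  -- a basic solution is determined by its support
  have hfin : P.Finite := by
    refine Set.Finite.of_finite_image (f := ratSupp) (Set.toFinite _) ?_
    rintro y ⟨-, hyx, hli⟩ y' ⟨-, hyx', -⟩ hs
    rw [linearIndepOn_finset_iff] at hli
    have h0 : ∑ j ∈ ratSupp y, (y j - y' j) • a j = 0 := by
      have hall : ∀ z : ι → ℚ, ∑ j ∈ ratSupp z, z j • a j = ∑ j, z j • a j := fun z =>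
        Finset.sum_subset (Finset.subset_univ _) fun j _ hj => by
          rw [not_not.1 (mt mem_ratSupp.2 hj), zero_smul]
      simp only [sub_smul, Finset.sum_sub_distrib]
      rw [hall y, hs, hall y', hyx, hyx', sub_self]
    funext j
    by_cases hj : j ∈ ratSupp y
    · exact sub_eq_zero.1 (hli _ h0 j hj)
    · have hj' := hs ▸ hj
      rw [not_not.1 (mt mem_ratSupp.2 hj), not_not.1 (mt mem_ratSupp.2 hj')]
  obtain ⟨y₀, h1, h2, -, h4⟩ := exists_basic a c hc x hx
  obtain ⟨y, ⟨hy, hyx, hyli⟩, hmax⟩ :=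
    hfin.exists_maximalFor (fun y => ∑ j, c j * y j) P ⟨y₀, h1, h2, h4⟩
  refine ⟨y, hy, hyx, hyli, fun z hz hzx => ?_⟩
  obtain ⟨y', h1, h2, h3, h4⟩ := exists_basic a c hc z hz
  rcases le_total (∑ j, c j * y' j) (∑ j, c j * y j) with h | h
  · exact h3.trans h
  · exact h3.trans (hmax ⟨h1, h2.trans hzx, h4⟩ h)

end LinearProgram

/-! ### Minors and indices of column lattices -/

variable {m n : ℕ}

lemma gcdMinor_dvd_det_submatrix (A : Matrix (Fin m) (Fin n) ℤ) (r : Fin m → Fin n) :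
    (gcdMinor A : ℤ) ∣ (A.submatrix id r).det := by
  by_cases hr : Function.Injective r
  · have hcard : (Finset.univ.image r).card = m := by
      rw [Finset.card_image_of_injective _ hr, Finset.card_univ, Fintype.card_fin]
    let e := (Finset.univ.image r).orderEmbOfFin hcard
    have hmem : ∀ i, ∃ k, e k = r i := fun i => by
      have : r i ∈ Set.range e := by
        rw [Finset.range_orderEmbOfFin]
        simp
      exact this
    choose σ hσ using hmem
    have hσi : Function.Injective σ := fun i j h => hr (by rw [← hσ, ← hσ, h])
    let π : Equiv.Perm (Fin m) := Equiv.ofBijective σ (Finite.injective_iff_bijective.1 hσi)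
    have hsub : A.submatrix id r = (A.submatrix id e).submatrix id π := by
      ext i j
      simp [π, hσ]
    rw [hsub, Matrix.det_permute']
    refine Dvd.dvd.mul_left ?_ _
    exact Int.natCast_dvd.2 (Finset.gcd_dvd (f := absMinor A) (Finset.mem_univ e))
  · obtain ⟨i, j, hij, hne⟩ : ∃ i j, r i = r j ∧ i ≠ j := by
      simpa [Function.Injective] using hr
    rw [Matrix.det_zero_of_column_eq hne fun k => by simp [hij]]
    exact dvd_zero _

/-- The divisibility part of the Cauchy–Binet formula: the determinant of any `m` integer combinations
of the columns of `A` is an integer combination of the `m × m` minors of `A`. -/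
lemma gcdMinor_dvd_det (A : Matrix (Fin m) (Fin n) ℤ) (E : Fin m → Fin n → ℤ) :
    (gcdMinor A : ℤ) ∣ (Matrix.of fun i => A.mulVec (E i)).det := by
  have h1 : (Matrix.of fun i => A.mulVec (E i)).det =
      Matrix.detRowAlternating (fun i => ∑ j, E i j • A.col j) := by
    congr 1
    ext i k
    simp [Matrix.mulVec, dotProduct, mul_comm]
  rw [h1]
  have h2 := MultilinearMap.map_sum
    (Matrix.detRowAlternating (n := Fin m) (R := ℤ)).toMultilinearMap
    (fun i j => E i j • A.col j)
  simp only [AlternatingMap.coe_multilinearMap] at h2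
  rw [h2]
  refine Finset.dvd_sum fun r _ => ?_
  have h3 := (Matrix.detRowAlternating (n := Fin m) (R := ℤ)).toMultilinearMap.map_smul_univ
    (fun i => E i (r i)) (fun i => A.col (r i))
  simp only [AlternatingMap.coe_multilinearMap] at h3
  rw [h3]
  refine Dvd.dvd.mul_left ?_ _
  have h4 : (Matrix.detRowAlternating fun i => A.col (r i)) = (A.submatrix id r).det := by
    rw [← Matrix.det_transpose]
    rfl
  rw [h4]
  exact gcdMinor_dvd_det_submatrix A r

/-- The subgroup of `ℤ^m` generated by the columns of an integer matrix. -/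
def columnLattice (A : Matrix (Fin m) (Fin n) ℤ) : AddSubgroup (Fin m → ℤ) :=
  (LinearMap.range A.mulVecLin).toAddSubgroup

lemma mem_columnLattice {A : Matrix (Fin m) (Fin n) ℤ} {b : Fin m → ℤ} :
    b ∈ columnLattice A ↔ ∃ x, A.mulVec x = b := by
  simp [columnLattice]

lemma index_columnLattice (B : Matrix (Fin m) (Fin m) ℤ) (hB : B.det ≠ 0) :
    (columnLattice B).index = B.det.natAbs := by
  have hinj : Function.Injective B.mulVecLin := fun _ _ h =>
    Matrix.mulVec_injective_of_det_ne_zero hB h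
  let bN : Module.Basis (Fin m) ℤ (columnLattice B) :=
    (Pi.basisFun ℤ (Fin m)).map (LinearEquiv.ofInjective B.mulVecLin hinj)
  rw [AddSubgroup.index_eq_natAbs_det (Pi.basisFun ℤ (Fin m)) _ bN, Pi.basisFun_det,
    ← B.det_transpose]
  congr 2
  ext i j
  change B.mulVecLin (Pi.basisFun ℤ (Fin m) i) j = _
  simp

/-- The vector in `ℤ^n` with entries `y_i` at the positions selected by `e` and zeros elsewhere. -/
def embedVec (e : Fin m ↪o Fin n) (y : Fin m → ℤ) : Fin n → ℤ := ∑ i, Pi.single (e i) (y i)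

lemma embedVec_apply (e : Fin m ↪o Fin n) (y : Fin m → ℤ) (i : Fin m) :
    embedVec e y (e i) = y i := by
  simp [embedVec, Finset.sum_apply, Pi.single_apply]

lemma embedVec_eq_zero (e : Fin m ↪o Fin n) (y : Fin m → ℤ) {j : Fin n} (hj : j ∉ Set.range e) :
    embedVec e y j = 0 := by
  rw [embedVec, Finset.sum_apply]
  exact Finset.sum_eq_zero fun i _ => Pi.single_eq_of_ne (fun h => hj ⟨i, h.symm⟩) _

lemma embedVec_nonneg (e : Fin m ↪o Fin n) {y : Fin m → ℤ} (hy : ∀ i, 0 ≤ y i) (j : Fin n) :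
    0 ≤ embedVec e y j := by
  by_cases hj : j ∈ Set.range e
  · obtain ⟨i, rfl⟩ := hj
    rw [embedVec_apply]
    exact hy i
  · rw [embedVec_eq_zero e y hj]

lemma mulVec_embedVec (A : Matrix (Fin m) (Fin n) ℤ) (e : Fin m ↪o Fin n) (y : Fin m → ℤ) :
    A.mulVec (embedVec e y) = (A.submatrix id e).mulVec y := by
  rw [embedVec, Matrix.mulVec_sum]
  ext k
  simp [Matrix.mulVec, dotProduct, Finset.sum_apply, mul_comm]

lemma columnLattice_submatrix_le (A : Matrix (Fin m) (Fin n) ℤ) (e : Fin m ↪o Fin n) :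
    columnLattice (A.submatrix id e) ≤ columnLattice A := by
  intro b hb
  obtain ⟨x, rfl⟩ := mem_columnLattice.1 hb
  exact mem_columnLattice.2 ⟨embedVec e x, mulVec_embedVec A e x⟩

lemma index_columnLattice_ne_zero (A : Matrix (Fin m) (Fin n) ℤ) (e : Fin m ↪o Fin n)
    (he : (A.submatrix id e).det ≠ 0) : (columnLattice A).index ≠ 0 := by
  intro h
  have h1 := AddSubgroup.index_dvd_of_le (columnLattice_submatrix_le A e)
  rw [h, index_columnLattice _ he, zero_dvd_iff, Int.natAbs_eq_zero] at h1
  exact he h1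

/-- The gcd of the `m × m` minors divides the index of the column lattice (it is in fact equal to
it). -/
lemma gcdMinor_dvd_index (A : Matrix (Fin m) (Fin n) ℤ) (e : Fin m ↪o Fin n)
    (he : (A.submatrix id e).det ≠ 0) : gcdMinor A ∣ (columnLattice A).index := by
  have hfin : (columnLattice A).FiniteIndex := ⟨index_columnLattice_ne_zero A e he⟩
  have hq : Finite ((Fin m → ℤ) ⧸ (columnLattice A).toIntSubmodule) :=
    (inferInstance : Finite ((Fin m → ℤ) ⧸ columnLattice A))
  have hrank : Module.finrank ℤ (columnLattice A) = m := by
    have := (Submodule.finiteQuotient_iff (columnLattice A).toIntSubmodule).1 hq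
    rw [Module.finrank_fin_fun] at this
    exact this
  let bN : Module.Basis (Fin m) ℤ (columnLattice A) := Module.finBasisOfFinrankEq ℤ _ hrank
  choose E hE using fun i => mem_columnLattice.1 (bN i).2
  rw [AddSubgroup.index_eq_natAbs_det (Pi.basisFun ℤ (Fin m)) _ bN, Pi.basisFun_det,
    ← Int.natCast_dvd]
  have h := gcdMinor_dvd_det A E
  simp only [hE] at h
  exact h

/-- The class of the `j`-th column of `A` modulo the lattice spanned by the columns selected
by `e`. -/
def columnClass (A : Matrix (Fin m) (Fin n) ℤ) (e : Fin m ↪o Fin n) (j : Fin n) :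
    (Fin m → ℤ) ⧸ columnLattice (A.submatrix id e) :=
  QuotientAddGroup.mk (A.col j)

lemma sum_smul_columnClass (A : Matrix (Fin m) (Fin n) ℤ) (e : Fin m ↪o Fin n) (w : Fin n → ℕ) :
    ∑ j, w j • columnClass A e j =
      QuotientAddGroup.mk' (columnLattice (A.submatrix id e)) (A.mulVec fun j => (w j : ℤ)) := by
  have : (A.mulVec fun j => (w j : ℤ)) = ∑ j, w j • A.col j := by
    ext i
    simp [Matrix.mulVec, dotProduct, mul_comm]
  rw [this, map_sum]
  exact Finset.sum_congr rfl fun j _ => (map_nsmul (QuotientAddGroup.mk' _) (w j) (A.col j)).symm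

lemma finite_quotient_columnLattice (B : Matrix (Fin m) (Fin m) ℤ) (hB : B.det ≠ 0) :
    Finite ((Fin m → ℤ) ⧸ columnLattice B) := by
  have : (columnLattice B).FiniteIndex :=
    ⟨by rw [index_columnLattice B hB]; exact Int.natAbs_ne_zero.2 hB⟩
  infer_instance

/-- The group `Aℤⁿ / Bℤᵐ` has order at most `|det B| / γ`. -/
lemma ncard_reachable_mul_gcdMinor_le (A : Matrix (Fin m) (Fin n) ℤ) (e : Fin m ↪o Fin n)
    (he : (A.submatrix id e).det ≠ 0) :
    (reachable (columnClass A e)).ncard * gcdMinor A ≤ absMinor A e := by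
  set L := columnLattice (A.submatrix id e)
  have hfin : Finite ((Fin m → ℤ) ⧸ L) := finite_quotient_columnLattice _ he
  let M := (columnLattice A).map (QuotientAddGroup.mk' L)
  have h1 : (reachable (columnClass A e)).ncard ≤ Nat.card M := by
    rw [← SetLike.coe_sort_coe, Nat.card_coe_set_eq]
    refine Set.ncard_le_ncard ?_ (Set.toFinite _)
    rintro _ ⟨w, rfl⟩
    refine ⟨A.mulVec fun j => (w j : ℤ), mem_columnLattice.2 ⟨_, rfl⟩, ?_⟩
    exact (sum_smul_columnClass A e w).symm
  have h2 : M.index = (columnLattice A).index :=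
    AddSubgroup.index_map_eq _ (QuotientAddGroup.mk'_surjective L)
      (by rw [QuotientAddGroup.ker_mk']; exact columnLattice_submatrix_le A e)
  have h3 : Nat.card M * M.index = absMinor A e := by
    rw [AddSubgroup.card_mul_index]
    exact index_columnLattice _ he
  have h4 : gcdMinor A ≤ M.index := by
    rw [h2]
    exact Nat.le_of_dvd (Nat.pos_of_ne_zero (index_columnLattice_ne_zero A e he))
      (gcdMinor_dvd_index A e he)
  exact h3 ▸ Nat.mul_le_mul h1 h4

/-- Columns of `A` forming a basis over a field of characteristic zero are selected by an order
embedding with nonzero minor. -/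
lemma exists_minor_ne_zero {K : Type*} [Field K] [CharZero K] (A : Matrix (Fin m) (Fin n) ℤ)
    (J : Finset (Fin n))
    (hli : LinearIndepOn K (fun j => (A.map (Int.cast : ℤ → K)).col j) (J : Set (Fin n)))
    (hspan : Submodule.span K ((fun j => (A.map (Int.cast : ℤ → K)).col j) '' J) = ⊤) :
    ∃ e : Fin m ↪o Fin n, Set.range e = J ∧ (A.submatrix id e).det ≠ 0 := by
  have hcard : J.card = m := by
    have h1 := finrank_span_eq_card (R := K) hli
    rw [← Set.image_eq_range, hspan] at h1
    simpa using h1.symm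
  refine ⟨J.orderEmbOfFin hcard, Finset.range_orderEmbOfFin J hcard, fun h => ?_⟩
  have h1 : LinearIndependent K
      ((A.map (Int.cast : ℤ → K)).submatrix id (J.orderEmbOfFin hcard)).col :=
    hli.comp (fun i => ⟨J.orderEmbOfFin hcard i, Finset.orderEmbOfFin_mem J hcard i⟩)
      fun i j hij => (J.orderEmbOfFin hcard).injective (congrArg Subtype.val hij)
  have h2 := (Matrix.isUnit_iff_isUnit_det _).1 (Matrix.linearIndependent_cols_iff_isUnit.1 h1)
  have h3 : ((A.map (Int.cast : ℤ → K)).submatrix id (J.orderEmbOfFin hcard)).det =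
      ((A.submatrix id (J.orderEmbOfFin hcard)).det : K) := by
    rw [Matrix.submatrix_map]
    exact (Int.cast_det _).symm
  rw [h3, h] at h2
  simp at h2

lemma exists_minor_ne_zero_of_rank (A : Matrix (Fin m) (Fin n) ℤ)
    (hA : (A.map (Int.cast : ℤ → ℝ)).rank = m) :
    ∃ e : Fin m ↪o Fin n, (A.submatrix id e).det ≠ 0 := by
  have htop : Submodule.span ℝ (Set.range (A.map (Int.cast : ℤ → ℝ)).col) = ⊤ := by
    refine Submodule.eq_top_of_finrank_eq ?_
    rw [← Matrix.rank_eq_finrank_span_cols, hA]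
    simp
  obtain ⟨J, -, -, hJ, hli⟩ := exists_linearIndepOn_extension
    (linearIndepOn_empty ℝ (A.map (Int.cast : ℤ → ℝ)).col) (Set.empty_subset Set.univ)
  classical
  obtain ⟨e, -, he⟩ := exists_minor_ne_zero (K := ℝ) A J.toFinset (by simpa using hli) (by
    rw [Set.image_univ] at hJ
    rw [Set.coe_toFinset, eq_top_iff, ← htop]
    exact Submodule.span_le.2 hJ)
  exact ⟨e, he⟩

/-! ### Cones of dual feasible bases -/

/-- The vector `det(B)² B⁻¹ b`, where `B` is the submatrix of `A` selected by `e`. The factor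
`det(B)²` makes it integral without changing the signs of its entries. -/
def basicCoord (A : Matrix (Fin m) (Fin n) ℤ) (e : Fin m ↪o Fin n) (b : Fin m → ℤ) : Fin m → ℤ :=
  ((A.submatrix id e).det • (A.submatrix id e).adjugate).mulVec b

/-- The cone generated by the columns of `A` selected by `e`, if these are linearly independent. -/
def basisCone (A : Matrix (Fin m) (Fin n) ℤ) (e : Fin m ↪o Fin n) : Set (Fin m → ℤ) :=
  ⋂ i, {b | 0 ≤ basicCoord A e b i}

/-- The reduced cost of the `j`-th variable at the basis `e`, with the sign for which it is
nonnegative at an optimal basis of the maximization problem, multiplied by `det(B)²`. -/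
def reducedCost (A : Matrix (Fin m) (Fin n) ℤ) (c : Fin n → ℚ) (e : Fin m ↪o Fin n) (j : Fin n) :
    ℚ :=
  ∑ i, c (e i) * (basicCoord A e (A.col j) i : ℚ) - ((A.submatrix id e).det : ℚ) ^ 2 * c j

/-- `e` selects a dual feasible basis of the linear relaxation. -/
def IsDualFeasible (A : Matrix (Fin m) (Fin n) ℤ) (c : Fin n → ℚ) (e : Fin m ↪o Fin n) : Prop :=
  (A.submatrix id e).det ≠ 0 ∧ ∀ j, 0 ≤ reducedCost A c e j

lemma basicCoord_mulVec_submatrix (A : Matrix (Fin m) (Fin n) ℤ) (e : Fin m ↪o Fin n)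
    (y : Fin m → ℤ) (i : Fin m) :
    basicCoord A e ((A.submatrix id e).mulVec y) i = (A.submatrix id e).det ^ 2 * y i := by
  rw [basicCoord, Matrix.mulVec_mulVec, Matrix.smul_mul, Matrix.adjugate_mul, smul_smul,
    Matrix.smul_mulVec, Matrix.one_mulVec, Pi.smul_apply, smul_eq_mul, sq]

lemma mulVec_basicCoord (A : Matrix (Fin m) (Fin n) ℤ) (e : Fin m ↪o Fin n) (b : Fin m → ℤ) :
    (A.submatrix id e).mulVec (basicCoord A e b) = (A.submatrix id e).det ^ 2 • b := by
  rw [basicCoord, Matrix.mulVec_mulVec, Matrix.mul_smul, Matrix.mul_adjugate, smul_smul,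
    Matrix.smul_mulVec, Matrix.one_mulVec, sq]

lemma basicCoord_col (A : Matrix (Fin m) (Fin n) ℤ) (e : Fin m ↪o Fin n) (k i : Fin m) :
    basicCoord A e (A.col (e k)) i = if i = k then (A.submatrix id e).det ^ 2 else 0 := by
  have : A.col (e k) = (A.submatrix id e).mulVec (Pi.single k 1) := by
    rw [Matrix.mulVec_single_one]
    rfl
  rw [this, basicCoord_mulVec_submatrix]
  simp [Pi.single_apply]

/-- `basicCoord` commutes with rational combinations of the columns. -/
lemma basicCoord_eq_sum (A : Matrix (Fin m) (Fin n) ℤ) (e : Fin m ↪o Fin n) (b : Fin m → ℤ)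
    (x : Fin n → ℚ) (hx : ∀ k, ∑ j, (A k j : ℚ) * x j = b k) (i : Fin m) :
    (basicCoord A e b i : ℚ) = ∑ j, (basicCoord A e (A.col j) i : ℚ) * x j := by
  simp only [basicCoord, Matrix.mulVec, dotProduct, Int.cast_sum, Int.cast_mul, ← hx,
    Matrix.col_apply, Finset.mul_sum, Finset.sum_mul]
  rw [Finset.sum_comm]
  exact Finset.sum_congr rfl fun _ _ => Finset.sum_congr rfl fun _ _ => by ring

lemma basicCoord_sub (A : Matrix (Fin m) (Fin n) ℤ) (e : Fin m ↪o Fin n) (b b' : Fin m → ℤ)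
    (i : Fin m) : basicCoord A e (b - b') i = basicCoord A e b i - basicCoord A e b' i := by
  simp [basicCoord, Matrix.mulVec_sub]

lemma asympInvariant_basisCone (A : Matrix (Fin m) (Fin n) ℤ) (e : Fin m ↪o Fin n) :
    AsympInvariant (basisCone A e) :=
  AsympInvariant.iInter fun i =>
    asympInvariant_halfspace (((A.submatrix id e).det • (A.submatrix id e).adjugate) i)

/-- Almost all points of the cone of a basis are far away from its facets. -/
lemma negligible_basisCone_boundary (A : Matrix (Fin m) (Fin n) ℤ) (e : Fin m ↪o Fin n)
    (he : (A.submatrix id e).det ≠ 0) (K : ℤ) :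
    Negligible {b | b ∈ basisCone A e ∧ ∃ i, basicCoord A e b i < K} := by
  refine (Negligible.biUnion (Set.finite_univ (α := Fin m)) fun i _ =>
    negligible_slab (((A.submatrix id e).det • (A.submatrix id e).adjugate) i) ?_ K).mono ?_
  · intro h
    have h1 := basicCoord_col A e i i
    rw [basicCoord, Matrix.mulVec, h, zero_dotProduct, if_pos rfl] at h1
    exact he (pow_eq_zero_iff two_ne_zero |>.1 h1.symm)
  · rintro b ⟨hb, i, hi⟩
    simp only [Set.mem_iUnion]
    exact ⟨i, trivial, Set.mem_iInter.1 hb i, hi⟩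

lemma reducedCost_basis (A : Matrix (Fin m) (Fin n) ℤ) (c : Fin n → ℚ) (e : Fin m ↪o Fin n)
    (k : Fin m) : reducedCost A c e (e k) = 0 := by
  simp only [reducedCost, basicCoord_col]
  simp [mul_comm]

lemma det_sq_mul_objective (A : Matrix (Fin m) (Fin n) ℤ) (c : Fin n → ℚ) (e : Fin m ↪o Fin n)
    (b : Fin m → ℤ) (x : Fin n → ℚ) (hx : ∀ k, ∑ j, (A k j : ℚ) * x j = b k) :
    ((A.submatrix id e).det : ℚ) ^ 2 * ∑ j, c j * x j =
      ∑ i, c (e i) * (basicCoord A e b i : ℚ) - ∑ j, reducedCost A c e j * x j := by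
  have h1 : ∑ i, c (e i) * (basicCoord A e b i : ℚ) =
      ∑ j, (∑ i, c (e i) * (basicCoord A e (A.col j) i : ℚ)) * x j := by
    simp only [basicCoord_eq_sum A e b x hx, Finset.mul_sum, Finset.sum_mul]
    rw [Finset.sum_comm]
    exact Finset.sum_congr rfl fun _ _ => Finset.sum_congr rfl fun _ _ => by ring
  rw [h1, ← Finset.sum_sub_distrib, Finset.mul_sum]
  exact Finset.sum_congr rfl fun j _ => by rw [reducedCost]; ring

lemma mulVec_eq_iff_rat (A : Matrix (Fin m) (Fin n) ℤ) (b : Fin m → ℤ) (z : Fin n → ℤ) :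
    A.mulVec z = b ↔ ∀ k, ∑ j, (A k j : ℚ) * (z j : ℚ) = b k := by
  rw [funext_iff]
  refine forall_congr' fun k => ?_
  rw [Matrix.mulVec, dotProduct]
  exact_mod_cast Iff.rfl

/-- Gomory's group relaxation is exact far away from the facets of the cone of a dual feasible basis:
an optimal solution of the group problem extends to an optimal solution of the integer program. -/
lemma IsDualFeasible.exists_isOptimal {A : Matrix (Fin m) (Fin n) ℤ} {c : Fin n → ℚ}
    {e : Fin m ↪o Fin n} (he : IsDualFeasible A c e) {w : Fin n → ℕ}
    (hw : IsGroupOptimal (columnClass A e) (reducedCost A c e) w) {b : Fin m → ℤ}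
    (hb : ∑ j, w j • columnClass A e j = QuotientAddGroup.mk' (columnLattice (A.submatrix id e)) b)
    (hdeep : ∀ i, basicCoord A e (A.mulVec fun j => (w j : ℤ)) i ≤ basicCoord A e b i) :
    ∃ z, IsOptimal A c b z ∧ (supp z).card ≤ m + (natSupp w).card := by
  obtain ⟨y, hy⟩ : ∃ y, (A.submatrix id e).mulVec y = b - A.mulVec fun j => (w j : ℤ) := by
    rw [sum_smul_columnClass] at hb
    refine mem_columnLattice.1 ?_
    have := QuotientAddGroup.eq.1 hb
    rwa [neg_add_eq_sub] at this
  have hdet : 0 < (A.submatrix id e).det ^ 2 := by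
    have := he.1
    positivity
  have hy0 : ∀ i, 0 ≤ y i := fun i => by
    have h1 := basicCoord_mulVec_submatrix A e y i
    rw [hy, basicCoord_sub] at h1
    have h2 := hdeep i
    exact nonneg_of_mul_nonneg_right (by linarith) hdet
  have hz : IsFeasible A b ((fun j => (w j : ℤ)) + embedVec e y) := by
    refine ⟨by rw [Matrix.mulVec_add, mulVec_embedVec, hy]; abel, fun j => ?_⟩
    exact add_nonneg (Int.natCast_nonneg _) (embedVec_nonneg e hy0 j)
  refine ⟨_, ⟨hz, fun z' hz' => ?_⟩, ?_⟩
  · have h1 := det_sq_mul_objective A c e b _ ((mulVec_eq_iff_rat A b _).1 hz.1)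
    have h2 := det_sq_mul_objective A c e b _ ((mulVec_eq_iff_rat A b _).1 hz'.1)
    have hcast : (fun j => ((z' j).toNat : ℤ)) = z' :=
      funext fun j => Int.toNat_of_nonneg (hz'.2 j)
    have h3 := hw (fun j => (z' j).toNat) (by
      rw [hb, sum_smul_columnClass, hcast, hz'.1])
    have h4 : ∑ j, w j • reducedCost A c e j =
        ∑ j, reducedCost A c e j * ((((fun j => (w j : ℤ)) + embedVec e y) j : ℤ) : ℚ) := by
      refine Finset.sum_congr rfl fun j _ => ?_
      by_cases hj : j ∈ Set.range e
      · obtain ⟨k, rfl⟩ := hj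
        simp [reducedCost_basis]
      · simp [embedVec_eq_zero e y hj, mul_comm]
    have h5 : ∑ j, (z' j).toNat • reducedCost A c e j =
        ∑ j, reducedCost A c e j * (z' j : ℚ) := by
      refine Finset.sum_congr rfl fun j _ => ?_
      have h6 : (((z' j).toNat : ℤ) : ℚ) = (z' j : ℚ) := by rw [Int.toNat_of_nonneg (hz'.2 j)]
      rw [← h6, Int.cast_natCast, nsmul_eq_mul, mul_comm]
    rw [h4, h5] at h3
    have hdetQ : (0 : ℚ) < ((A.submatrix id e).det : ℚ) ^ 2 := by exact_mod_cast hdet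
    refine le_of_mul_le_mul_left ?_ hdetQ
    unfold objective
    rw [h1, h2]
    linarith
  · have hsub : supp ((fun j => (w j : ℤ)) + embedVec e y) ⊆
        Finset.univ.image e ∪ natSupp w := by
      intro j hj
      rw [supp, Finset.mem_filter] at hj
      by_contra hj'
      simp only [Finset.mem_union, Finset.mem_image, Finset.mem_univ, true_and, mem_natSupp,
        not_or, not_not] at hj'
      have := hj.2
      simp [hj'.2, embedVec_eq_zero e y (j := j) hj'.1] at this
    refine (Finset.card_le_card hsub).trans ((Finset.card_union_le _ _).trans ?_)
    gcongr
    exact Finset.card_image_le.trans (by simp)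

/-- The integral right-hand sides in the span of columns of `A` which do not span the whole space. -/
def degenerateSet (A : Matrix (Fin m) (Fin n) ℤ) : Set (Fin m → ℤ) :=
  ⋃ J ∈ {J : Finset (Fin n) |
      Submodule.span ℚ ((fun j => (A.map (Int.cast : ℤ → ℚ)).col j) '' J) ≠ ⊤},
    {b | (fun i => (b i : ℚ)) ∈
      Submodule.span ℚ ((fun j => (A.map (Int.cast : ℤ → ℚ)).col j) '' J)}

lemma negligible_degenerateSet (A : Matrix (Fin m) (Fin n) ℤ) : Negligible (degenerateSet A) := by
  refine Negligible.biUnion (Set.toFinite _) fun J hJ => ?_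
  obtain ⟨f, hf, hle⟩ := Submodule.exists_le_ker_of_lt_top _ (lt_top_iff_ne_top.2 hJ)
  have hsum : ∀ x, f x = ∑ i, f (Pi.single i 1) * x i := fun x => by
    rw [LinearMap.pi_apply_eq_sum_univ f x]
    exact Finset.sum_congr rfl fun i _ => by
      rw [smul_eq_mul, mul_comm]
      congr 2
      ext j
      simp [Pi.single_apply, eq_comm]
  refine (negligible_hyperplane (fun i => f (Pi.single i 1)) (fun h => hf ?_) 0).mono ?_
  · ext i
    simpa using congrFun h i
  · intro b hb
    have h1 := hle hb
    rw [LinearMap.mem_ker, hsum] at h1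
    exact h1

/-- Every feasible right-hand side outside a negligible set lies in the cone of a dual feasible
basis: a nondegenerate basic optimal solution of the linear relaxation has nonnegative reduced
costs. -/
lemma exists_isDualFeasible (A : Matrix (Fin m) (Fin n) ℤ) (c : Fin n → ℚ)
    (hc : ∀ x : Fin n → ℚ, (∀ j, 0 ≤ x j) →
      ∑ j, x j • (A.map (Int.cast : ℤ → ℚ)).col j = 0 → ∑ j, c j * x j ≤ 0)
    {b : Fin m → ℤ} {z : Fin n → ℤ} (hz : IsFeasible A b z) (hb : b ∉ degenerateSet A) :
    ∃ e, IsDualFeasible A c e ∧ b ∈ basisCone A e := by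
  have hcols : ∀ (x : Fin n → ℚ) k,
      (∑ j, x j • (A.map (Int.cast : ℤ → ℚ)).col j) k = ∑ j, (A k j : ℚ) * x j := fun x k => by
    simp [Finset.sum_apply, mul_comm]
  obtain ⟨y, hy, hyb, hli, hopt⟩ := exists_basic_optimal
    (fun j => (A.map (Int.cast : ℤ → ℚ)).col j) c hc (fun j => (z j : ℚ))
    fun j => Int.cast_nonneg (hz.2 j)
  have hyb' : ∀ k, ∑ j, (A k j : ℚ) * y j = b k := fun k => by
    rw [← hcols, hyb, hcols]
    exact (mulVec_eq_iff_rat A b z).1 hz.1 k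
  have hspan : Submodule.span ℚ
      ((fun j => (A.map (Int.cast : ℤ → ℚ)).col j) '' (ratSupp y : Set (Fin n))) = ⊤ := by
    by_contra hne
    refine hb (Set.mem_biUnion (show ratSupp y ∈ {J : Finset (Fin n) |
      Submodule.span ℚ ((fun j => (A.map (Int.cast : ℤ → ℚ)).col j) '' J) ≠ ⊤} from hne) ?_)
    have h1 : (fun i => (b i : ℚ)) = ∑ j, y j • (A.map (Int.cast : ℤ → ℚ)).col j :=
      funext fun k => by rw [hcols, hyb']
    change (fun i => (b i : ℚ)) ∈ Submodule.span ℚ _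
    rw [h1]
    refine Submodule.sum_mem _ fun j _ => ?_
    by_cases hj : y j = 0
    · simp [hj]
    · exact Submodule.smul_mem _ _ (Submodule.subset_span ⟨j, mem_ratSupp.2 hj, rfl⟩)
  obtain ⟨e, hrange, hdet⟩ := exists_minor_ne_zero A (ratSupp y) hli hspan
  have hzero : ∀ j, j ∉ Set.range e → y j = 0 := fun j hj => by
    rw [hrange] at hj
    exact not_not.1 (mt mem_ratSupp.2 hj)
  have hpos : ∀ i, 0 < y (e i) := fun i => by
    have h1 : e i ∈ (ratSupp y : Set (Fin n)) := hrange ▸ Set.mem_range_self i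
    exact lt_of_le_of_ne (hy _) (mem_ratSupp.1 h1).symm
  refine ⟨e, ⟨hdet, fun j => ?_⟩, Set.mem_iInter.2 fun i => ?_⟩
  · -- the direction in which `x_j` enters and the basic variables compensate
    let v : Fin n → ℤ := Pi.single j ((A.submatrix id e).det ^ 2) -
      embedVec e (basicCoord A e (A.col j))
    have hv : A.mulVec v = 0 := by
      rw [Matrix.mulVec_sub, mulVec_embedVec, mulVec_basicCoord]
      ext k
      simp [mul_comm]
    have hv' := (mulVec_eq_iff_rat A 0 v).1 hv
    have hvnn : ∀ k, k ∉ Set.range e → 0 ≤ v k := fun k hk => by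
      simp only [v, Pi.sub_apply, embedVec_eq_zero e _ hk, sub_zero, Pi.single_apply]
      split_ifs
      · positivity
      · exact le_rfl
    obtain ⟨ε, hεpos, hε⟩ : ∃ ε : ℚ, 0 < ε ∧ ∀ k, 0 ≤ y k + ε * v k := by
      have hev : ∀ᶠ ε : ℚ in nhdsWithin 0 (Set.Ioi 0), ∀ k, 0 ≤ y k + ε * v k := by
        refine eventually_all.2 fun k => ?_
        by_cases hk : k ∈ Set.range e
        · obtain ⟨i, rfl⟩ := hk
          have ht : Tendsto (fun ε : ℚ => y (e i) + ε * v (e i)) (nhdsWithin 0 (Set.Ioi 0))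
              (nhds (y (e i) + 0 * v (e i))) :=
            (Continuous.tendsto (by fun_prop) 0).mono_left nhdsWithin_le_nhds
          rw [zero_mul, add_zero] at ht
          exact (ht.eventually_const_lt (hpos i)).mono fun _ h => h.le
        · filter_upwards [self_mem_nhdsWithin] with ε hε
          have h1 : (0 : ℚ) ≤ v k := Int.cast_nonneg (hvnn k hk)
          have h2 : (0 : ℚ) < ε := hε
          rw [hzero k hk]
          positivity
      obtain ⟨ε, h1, h2⟩ := (hev.and self_mem_nhdsWithin).exists
      exact ⟨ε, h2, h1⟩
    have h1 := hopt (fun k => y k + ε * v k) hε (by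
      rw [← hyb]
      funext k
      rw [hcols, hcols]
      have h2 := hv' k
      simp only [mul_add, Finset.sum_add_distrib, mul_left_comm _ ε, ← Finset.mul_sum, h2]
      simp)
    simp only [mul_add, Finset.sum_add_distrib, mul_left_comm _ ε, ← Finset.mul_sum] at h1
    have h2 : ∑ k, c k * (v k : ℚ) ≤ 0 := by
      by_contra hlt
      have := mul_pos hεpos (not_le.1 hlt)
      linarith
    have h3 : ∑ k, c k * (v k : ℚ) = -reducedCost A c e j := by
      have h4 : ∑ k, c k * (embedVec e (basicCoord A e (A.col j)) k : ℚ) =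
          ∑ i, c (e i) * (basicCoord A e (A.col j) i : ℚ) := by
        rw [← Finset.sum_subset (Finset.subset_univ (Finset.univ.image e)),
          Finset.sum_image fun _ _ _ _ h => e.injective h]
        · exact Finset.sum_congr rfl fun i _ => by rw [embedVec_apply]
        · intro k _ hk
          rw [embedVec_eq_zero e _ (by simpa using hk)]
          simp
      have h5 : ∑ k, c k * ((Pi.single j ((A.submatrix id e).det ^ 2) : Fin n → ℤ) k : ℚ) =
          ((A.submatrix id e).det : ℚ) ^ 2 * c j := by
        simp [Pi.single_apply, mul_comm]
      simp only [v, Pi.sub_apply, Int.cast_sub, mul_sub, Finset.sum_sub_distrib]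
      rw [h4, h5, reducedCost]
      ring
    linarith
  · have h1 : (basicCoord A e b i : ℚ) = ((A.submatrix id e).det : ℚ) ^ 2 * y (e i) := by
      rw [basicCoord_eq_sum A e b y hyb', ← Finset.sum_subset
        (Finset.subset_univ (Finset.univ.image e)), Finset.sum_image fun _ _ _ _ h => e.injective h]
      · simp [basicCoord_col]
      · intro k _ hk
        rw [hzero k (by simpa using hk), mul_zero]
    have h2 : (0 : ℚ) ≤ basicCoord A e b i := by
      rw [h1]
      have := hpos i
      positivity
    exact_mod_cast h2

/-! ### Densities of sparse right-hand sides -/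

/-- The right-hand sides for which the integer program is feasible. -/
def feasibleSet (A : Matrix (Fin m) (Fin n) ℤ) : Set (Fin m → ℤ) := {b | ∃ z, IsFeasible A b z}

/-- The right-hand sides with an optimal solution of support size at most `s`. -/
def sparseSet (A : Matrix (Fin m) (Fin n) ℤ) (c : Fin n → ℚ) (s : ℕ) : Set (Fin m → ℤ) :=
  {b | ∃ z, IsOptimal A c b z ∧ (supp z).card ≤ s}

/-- In the cone of a dual feasible basis, the proportion of right-hand sides with a sparse optimal
solution is governed by the group problem. -/
lemma IsDualFeasible.asympLE {A : Matrix (Fin m) (Fin n) ℤ} {c : Fin n → ℚ} {e : Fin m ↪o Fin n}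
    (he : IsDualFeasible A c e) {ρ : ℝ} (hρ : 0 ≤ ρ) {k : ℕ}
    (hk : ρ * (reachable (columnClass A e)).ncard ≤
      (sparseReachable (columnClass A e) (reducedCost A c e) k).ncard)
    {T : Set (Fin m → ℤ)} (hT : AsympInvariant T) :
    AsympLE ρ (basisCone A e ∩ T ∩ feasibleSet A) (basisCone A e ∩ T ∩ sparseSet A c (m + k)) := by
  classical
  have hfin : Finite ((Fin m → ℤ) ⧸ columnLattice (A.submatrix id e)) :=
    finite_quotient_columnLattice _ he.1
  let π := QuotientAddGroup.mk' (columnLattice (A.submatrix id e))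
  let R := (Set.toFinite (reachable (columnClass A e))).toFinset
  let H := (Set.toFinite (sparseReachable (columnClass A e) (reducedCost A c e) k)).toFinset
  have h1 : AsympLE ρ (basisCone A e ∩ T ∩ π ⁻¹' R) (basisCone A e ∩ T ∩ π ⁻¹' H) := by
    refine ((asympInvariant_basisCone A e).inter hT).asympLE_preimage π
      (QuotientAddGroup.mk'_surjective _) R H ρ ?_
    rwa [← Set.ncard_eq_toFinset_card, ← Set.ncard_eq_toFinset_card]
  have hH : ∀ g : H, ∃ w, IsGroupOptimal (columnClass A e) (reducedCost A c e) w ∧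
      ∑ j, w j • columnClass A e j = g ∧ (natSupp w).card ≤ k := fun g => by
    have := g.2
    rwa [Set.Finite.mem_toFinset] at this
  choose w hw hwg hwk using hH
  -- a bound for the coordinates of the finitely many chosen solutions of group problems
  obtain ⟨K, hK⟩ : ∃ K : ℤ, ∀ p : H × Fin m,
      basicCoord A e (A.mulVec fun j => (w p.1 j : ℤ)) p.2 ≤ K := by
    obtain ⟨K, hK⟩ := (Set.finite_range fun p : H × Fin m =>
      basicCoord A e (A.mulVec fun j => (w p.1 j : ℤ)) p.2).bddAbove
    exact ⟨K, fun p => hK ⟨p, rfl⟩⟩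
  refine h1.of_union_negligible hρ negligible_empty
    (negligible_basisCone_boundary A e he.1 K) ?_ ?_
  · rintro b ⟨hb, z, hz, hz0⟩
    refine Or.inl ⟨hb, ?_⟩
    rw [Set.mem_preimage, Set.Finite.coe_toFinset]
    refine ⟨fun j => (z j).toNat, ?_⟩
    have hcast : (fun j => ((z j).toNat : ℤ)) = z :=
      funext fun j => Int.toNat_of_nonneg (hz0 j)
    simp only [sum_smul_columnClass, hcast, hz]
    rfl
  · rintro b ⟨hb, hbH⟩
    by_cases hdeep : ∃ i, basicCoord A e b i < K
    · exact Or.inr ⟨hb.1, hdeep⟩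
    · push Not at hdeep
      obtain ⟨z, hz, hcard⟩ := he.exists_isOptimal (hw ⟨π b, hbH⟩) (hwg ⟨π b, hbH⟩)
        fun i => (hK (⟨π b, hbH⟩, i)).trans (hdeep i)
      exact Or.inl ⟨hb, z, hz, hcard.trans (Nat.add_le_add_left (hwk _) m)⟩

lemma asympLE_feasibleSet_sparseSet (A : Matrix (Fin m) (Fin n) ℤ) (c : Fin n → ℚ)
    (hc : ∀ x : Fin n → ℚ, (∀ j, 0 ≤ x j) →
      ∑ j, x j • (A.map (Int.cast : ℤ → ℚ)).col j = 0 → ∑ j, c j * x j ≤ 0)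
    {ρ : ℝ} (hρ : 0 ≤ ρ) (k : ℕ)
    (hk : ∀ e, IsDualFeasible A c e → ρ * (reachable (columnClass A e)).ncard ≤
      (sparseReachable (columnClass A e) (reducedCost A c e) k).ncard) :
    AsympLE ρ (feasibleSet A) (sparseSet A c (m + k)) := by
  classical
  have h := asympLE_biUnion (Finset.univ.filter (IsDualFeasible A c)) (basisCone A)
    (fun e _ => asympInvariant_basisCone A e) hρ (feasibleSet A) (sparseSet A c (m + k))
    (fun e he T hT => ((Finset.mem_filter.1 he).2).asympLE hρ (hk e (Finset.mem_filter.1 he).2) hT)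
    Set.univ asympInvariant_univ
  refine h.of_union_negligible hρ (negligible_degenerateSet A) negligible_empty ?_ ?_
  · rintro b ⟨z, hz⟩
    by_cases hb : b ∈ degenerateSet A
    · exact Or.inr hb
    · obtain ⟨e, he, hbe⟩ := exists_isDualFeasible A c hc hz hb
      exact Or.inl ⟨⟨Set.mem_biUnion (by simpa using he) hbe, trivial⟩, z, hz⟩
  · exact fun b hb => Or.inl hb.2

/-- The feasible right-hand sides have positive lower density: the nonnegative integer combinations
of the columns of a basis already do. -/
lemma exists_le_boxCount_feasibleSet (A : Matrix (Fin m) (Fin n) ℤ) (e : Fin m ↪o Fin n)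
    (he : (A.submatrix id e).det ≠ 0) :
    ∃ κ : ℝ, 0 < κ ∧ ∀ t : ℕ, 1 ≤ t → κ * boxVolume m t ≤ boxCount (feasibleSet A) t := by
  let B := A.submatrix id e
  let M : ℕ := ∑ i, ∑ j, (B i j).natAbs + 1
  have hM : (0 : ℝ) < M := by positivity
  refine ⟨(1 / (3 * M : ℝ)) ^ m, by positivity, fun t ht => ?_⟩
  have hsub : ((Fintype.piFinset fun _ : Fin m => Finset.range (t / M + 1)).card : ℝ) ≤
      boxCount (feasibleSet A) t := by
    unfold boxCount
    rw [Nat.cast_le, ← Set.ncard_coe_finset]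
    refine Set.ncard_le_ncard_of_injOn (fun y => B.mulVec fun i => (y i : ℤ)) ?_ ?_
      (finite_box _ t)
    · intro y hy
      have hy : ∀ i, y i ≤ t / M := fun i => by
        have := Fintype.mem_piFinset.1 (Finset.mem_coe.1 hy) i
        rw [Finset.mem_range] at this
        omega
      refine ⟨⟨embedVec e fun i => (y i : ℤ), mulVec_embedVec A e _,
        embedVec_nonneg e fun i => Int.natCast_nonneg _⟩, ?_⟩
      rw [pi_norm_le_iff_of_nonneg (Nat.cast_nonneg t)]
      intro i
      rw [Int.norm_eq_abs]
      have h1 : |B.mulVec (fun i => (y i : ℤ)) i| ≤ ∑ j, |B i j| * (t / M : ℕ) := by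
        refine (Finset.abs_sum_le_sum_abs (fun j => B i j * (y j : ℤ)) Finset.univ).trans (Finset.sum_le_sum fun j _ => ?_)
        rw [abs_mul, Nat.abs_cast]
        gcongr
        exact_mod_cast hy j
      have h2 : ∑ j, |B i j| ≤ (M : ℤ) := by
        have h3 : ∑ j, (B i j).natAbs ≤ M :=
          (Finset.single_le_sum (f := fun i => ∑ j, (B i j).natAbs) (fun _ _ => Nat.zero_le _)
            (Finset.mem_univ i)).trans (Nat.le_succ _)
        calc ∑ j, |B i j| = ((∑ j, (B i j).natAbs : ℕ) : ℤ) := by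
              push_cast
              rfl
          _ ≤ M := by exact_mod_cast h3
      have h4 : |B.mulVec (fun i => (y i : ℤ)) i| ≤ (t : ℤ) := by
        refine h1.trans ?_
        rw [← Finset.sum_mul]
        calc (∑ j, |B i j|) * ((t / M : ℕ) : ℤ) ≤ (M : ℤ) * ((t / M : ℕ) : ℤ) := by gcongr
          _ ≤ t := by exact_mod_cast Nat.mul_div_le t M
      exact_mod_cast h4
    · intro y _ y' _ h
      have := Matrix.mulVec_injective_of_det_ne_zero he h
      funext i
      exact_mod_cast congrFun this i
  refine le_trans ?_ hsub
  rw [Fintype.card_piFinset]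
  simp only [Finset.card_range, Finset.prod_const, Finset.card_univ, Fintype.card_fin]
  rw [Nat.cast_pow, boxVolume, ← mul_pow]
  gcongr
  have h1 : (t : ℝ) < M * ((t / M + 1 : ℕ) : ℝ) := by
    exact_mod_cast Nat.lt_mul_div_succ t (Nat.succ_pos _)
  have h2 : (1 : ℝ) ≤ t := by exact_mod_cast ht
  rw [one_div, inv_mul_le_iff₀ (by positivity)]
  linarith

/-- A lower bound for the density of a set in the set of right-hand sides with an optimum. -/
lemma le_probLE (A : Matrix (Fin m) (Fin n) ℤ) (c : Fin n → ℚ)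
    (hA : ∃ e : Fin m ↪o Fin n, (A.submatrix id e).det ≠ 0) {ρ : ℝ} (hρ : 0 < ρ) {s : ℕ} {α : ℝ}
    (hs : (s : ℝ) ≤ α) (h : AsympLE ρ (feasibleSet A) (sparseSet A c s)) :
    ρ ≤ probLE (sparsity A c) α := by
  obtain ⟨e, he⟩ := hA
  obtain ⟨κ, hκ, hfeas⟩ := exists_le_boxCount_feasibleSet A e he
  obtain ⟨err, herr, hle⟩ := h
  set D : Set (Fin m → ℤ) := {b | sparsity A c b < ∞} with hD
  set N : Set (Fin m → ℤ) :=
    {b | ((sparsity A c b : ℝ≥0∞) : EReal) ≤ (α : EReal) ∧ sparsity A c b < ∞} with hN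
  have hdens : ∀ t : ℕ, densityAt (sparsity A c)
      {b | ((sparsity A c b : ℝ≥0∞) : EReal) ≤ (α : EReal)} t = boxCount N t / boxCount D t := by
    intro t
    unfold densityAt boxCount
    congr 4
    · ext b
      simp only [hN, Set.mem_ofPred_eq]
      tauto
    · ext b
      simp only [hD, Set.mem_ofPred_eq]
      tauto
  have hND : N ⊆ D := fun b hb => hb.2
  have hDF : D ⊆ feasibleSet A := fun b hb => by
    by_contra hno
    have htop : sparsity A c b = ⊤ := by
      simp only [sparsity, iInf_eq_top]
      exact fun z hz => absurd ⟨z, hz.1⟩ hno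
    exact absurd htop (ne_of_lt hb)
  have hYN : sparseSet A c s ⊆ N := by
    rintro b ⟨z, hz, hcard⟩
    have h1 : sparsity A c b ≤ ((s : ℕ) : ℝ≥0∞) :=
      (iInf₂_le z hz).trans (by exact_mod_cast hcard)
    refine ⟨?_, h1.trans_lt (ENNReal.natCast_lt_top s)⟩
    have h2 : ((sparsity A c b : ℝ≥0∞) : EReal) ≤ (((s : ℕ) : ℝ≥0∞) : EReal) := by
      exact_mod_cast h1
    refine h2.trans ?_
    rw [← ENNReal.ofReal_natCast, EReal.coe_ennreal_ofReal, max_eq_left (Nat.cast_nonneg s)]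
    exact EReal.coe_le_coe_iff.2 hs
  have hle1 : ∀ t, boxCount N t / boxCount D t ≤ 1 := fun t =>
    div_le_one_of_le₀ (boxCount_mono hND t) (boxCount_nonneg _ _)
  unfold probLE lowerDensity
  simp only [hdens]
  -- the number of right-hand sides with an optimum grows like the volume of the box
  have hDpos : ∀ᶠ t : ℕ in atTop, ρ * κ / 2 * boxVolume m t ≤ boxCount D t := by
    filter_upwards [herr.bound (show 0 < ρ * κ / 2 by positivity), eventually_ge_atTop 1]
      with t h1 h2
    rw [Real.norm_eq_abs, Real.norm_of_nonneg (boxVolume_pos m t).le] at h1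
    have h3 := mul_le_mul_of_nonneg_left (hfeas t h2) hρ.le
    have h4 := boxCount_mono (hYN.trans hND) t
    have h5 := hle t
    have h6 := le_abs_self (err t)
    nlinarith
  refine le_of_forall_lt fun x hx => ?_
  obtain ⟨y, hxy, hyρ⟩ := exists_between hx
  refine hxy.trans_le (le_liminf_of_le
    (isCoboundedUnder_ge_of_le atTop (x := 1) hle1) ?_)
  have hη : 0 < (ρ - y) * (ρ * κ / 2) := mul_pos (by linarith) (by positivity)
  filter_upwards [hDpos, herr.bound hη] with t h1 h2
  have hvol := boxVolume_pos m t
  have hDt : 0 < boxCount D t := lt_of_lt_of_le (by positivity) h1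
  rw [Real.norm_eq_abs, Real.norm_of_nonneg hvol.le] at h2
  rw [le_div_iff₀ hDt]
  have h3 := mul_le_mul_of_nonneg_left (boxCount_mono hDF t) hρ.le
  have h4 := hle t
  have h5 := boxCount_mono hYN t
  have h6 := le_abs_self (err t)
  have h7 := mul_le_mul_of_nonneg_left h1 (show 0 ≤ ρ - y by linarith)
  linarith

lemma probLE_le_one (f : (Fin m → ℤ) → ℝ≥0∞) (α : ℝ) : probLE f α ≤ 1 := by
  have hle : ∀ t, densityAt f {b | ((f b : ℝ≥0∞) : EReal) ≤ (α : EReal)} t ≤ 1 := fun t => by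
    refine div_le_one_of_le₀ (Nat.cast_le.2 (Set.ncard_le_ncard (fun b hb => hb.2) ?_))
      (Nat.cast_nonneg _)
    exact (finite_box Set.univ t).subset fun b hb => ⟨trivial, hb.1⟩
  refine liminf_le_of_le ⟨0, ?_⟩ fun y hy => ?_
  · refine eventually_map.2 (Eventually.of_forall fun t => ?_)
    unfold densityAt
    positivity
  · obtain ⟨t, ht⟩ := hy.exists
    exact ht.trans (hle t)

end ParamIP

theorem theorem1p1 (m n : ℕ) (A : Matrix (Fin m) (Fin n) ℤ) (c : Fin n → ℚ)
    (hA : (A.map (Int.cast : ℤ → ℝ)).rank = m)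
    (hc : ∀ x : Fin n → ℝ, (∀ i, 0 ≤ x i) → (A.map (Int.cast : ℤ → ℝ)).mulVec x = 0 →
      ∑ i, (c i : ℝ) * x i ≤ 0) :
    (∀ k : ℕ,
      (k : ℤ) ≤ ⌈Real.logb 2 ((ParamIP.gcdMinor A : ℝ)⁻¹ * (ParamIP.maxMinor A : ℝ))⌉ →
      min 1 ((2 : ℝ) ^ k / ((ParamIP.gcdMinor A : ℝ)⁻¹ * (ParamIP.maxMinor A : ℝ))) ≤
        ParamIP.probLE (ParamIP.sparsity A c) ((m : ℝ) + (k : ℝ))) ∧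
    ParamIP.probLE (ParamIP.sparsity A c)
      ((m : ℝ) + Real.logb 2 ((ParamIP.gcdMinor A : ℝ)⁻¹ * (ParamIP.maxMinor A : ℝ))) = 1 := by
  open ParamIP in
  obtain ⟨e₀, he₀⟩ := exists_minor_ne_zero_of_rank A hA
  have hc' : ∀ x : Fin n → ℚ, (∀ j, 0 ≤ x j) →
      ∑ j, x j • (A.map (Int.cast : ℤ → ℚ)).col j = 0 → ∑ j, c j * x j ≤ 0 := by
    intro x hx h0
    have h1 := hc (fun j => (x j : ℝ)) (fun j => Rat.cast_nonneg.2 (hx j)) (by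
      funext i
      have h2 := congrArg (Rat.cast : ℚ → ℝ) (congrFun h0 i)
      simpa [Matrix.mulVec, dotProduct, Finset.sum_apply, mul_comm] using h2)
    exact_mod_cast h1
  set q : ℝ := (gcdMinor A : ℝ)⁻¹ * (maxMinor A : ℝ) with hq
  have hγ0 : 0 < gcdMinor A := by
    refine Nat.pos_of_ne_zero fun h => he₀ ?_
    have := gcdMinor_dvd_det_submatrix A e₀
    rwa [h, Nat.cast_zero, zero_dvd_iff] at this
  have hγ : (0 : ℝ) < gcdMinor A := Nat.cast_pos.2 hγ0
  have hR : ∀ e : Fin m ↪o Fin n, (A.submatrix id e).det ≠ 0 →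
      ((reachable (columnClass A e)).ncard : ℝ) ≤ q := fun e he => by
    have h1 : (reachable (columnClass A e)).ncard * gcdMinor A ≤ maxMinor A :=
      (ncard_reachable_mul_gcdMinor_le A e he).trans
        (Finset.le_sup (f := absMinor A) (Finset.mem_univ e))
    rw [hq, ← div_eq_inv_mul, le_div_iff₀ hγ]
    exact_mod_cast h1
  have hq1 : 1 ≤ q := by
    refine le_trans ?_ (hR e₀ he₀)
    have hfin := finite_quotient_columnLattice _ he₀
    rw [Nat.one_le_cast, Nat.one_le_iff_ne_zero, ← Nat.pos_iff_ne_zero]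
    exact (Set.ncard_pos (Set.toFinite _)).2 (Set.range_nonempty _)
  have hq0 : 0 < q := by linarith
  refine ⟨fun k _ => ?_, le_antisymm (probLE_le_one _ _) ?_⟩
  · refine le_probLE A c ⟨e₀, he₀⟩ (by positivity) (s := m + k) (by push_cast; rfl)
      (asympLE_feasibleSet_sparseSet A c hc' (by positivity) k fun e he => ?_)
    have hfin := finite_quotient_columnLattice _ he.1
    have h1 := min_le_ncard_sparseReachable (columnClass A e) (reducedCost A c e) he.2 k
    have h2 : (min ((2 : ℝ) ^ k) ((reachable (columnClass A e)).ncard : ℝ)) ≤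
        (sparseReachable (columnClass A e) (reducedCost A c e) k).ncard := by exact_mod_cast h1
    refine le_trans (le_min ?_ ?_) h2
    · calc min 1 ((2 : ℝ) ^ k / q) * (reachable (columnClass A e)).ncard
          ≤ (2 : ℝ) ^ k / q * q := by
            gcongr
            · exact min_le_right _ _
            · exact hR e he.1
        _ = 2 ^ k := div_mul_cancel₀ _ hq0.ne'
    · exact mul_le_of_le_one_left (Nat.cast_nonneg _) (min_le_left _ _)
  · have hlog : 0 ≤ Real.logb 2 q := Real.logb_nonneg one_lt_two hq1
    refine le_probLE A c ⟨e₀, he₀⟩ one_pos (s := m + ⌊Real.logb 2 q⌋₊)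
      (by push_cast; gcongr; exact Nat.floor_le hlog)
      (asympLE_feasibleSet_sparseSet A c hc' zero_le_one _ fun e he => ?_)
    have hfin := finite_quotient_columnLattice _ he.1
    rw [one_mul, Nat.cast_le]
    refine Set.ncard_le_ncard (reachable_subset_sparseReachable _ _ he.2 ?_) (Set.toFinite _)
    have h1 : q < 2 ^ (⌊Real.logb 2 q⌋₊ + 1) := by
      rw [← Real.rpow_natCast, ← Real.logb_lt_iff_lt_rpow one_lt_two hq0]
      push_cast
      exact Nat.lt_floor_add_one _
    exact_mod_cast (hR e he.1).trans_lt h1
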